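/- Conventions. For probability vectors $p\in\mathbb R^m$, $q\in\mathbb R^n$ let $p\otimes q=(p_iq_j)_{i,j}$. An uncertainty function $u$ assigns to every probability vector of every finite dimension a value in $[-\infty,\infty]$, which is a real number whenever all entries of the vector are positive. Let $\mathcal U$ be the family of all such $u$ that are Schur-concave, i.e. $u(p)\le u(\Lambda p)$ for every probability vector $p$ and every bistochastic matrix $\Lambda$, and additive, i.e. $u(p\otimes q)=u(p)+u(q)$. Let $\mathcal U_+\subset\mathcal U$ be the subfamily of those $u$ that are moreover real-valued and continuous on the probability simplex of each dimension. Call $u$ strictly Schur-concave if $u(p)<u(\Lambda p)$ whenever $p$ has positive entries and the vector $\Lambda p$ is not a permutation of $p$. For probability vectors $p\in\mathbb R^d$ with positive entries the Rényi entropies are $H_\alpha(p)=\frac{\operatorname{sgn}\alpha}{1-\alpha}\ln\sum_ip_i^\alpha$ for real $\alpha\ne0,1$, and $H_0(p)=\frac1d\sum_i\ln p_i$, $H_1(p)=-\sum_ip_i\ln p_i$, $H_\infty(p)=-\ln\max_ip_i$, $H_{-\infty}(p)=\ln\min_ip_i$. Let $\mathcal B_d$ be the set of density matrices on $\mathbb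 C^d$ and $\mathcal B_d^\epsilon=\{\epsilon\mathbb I/d+(1-\epsilon)\rho:\rho\in\mathcal B_d\}$. For observables $A,B$ with orthonormal eigenbases $(a_i)$, $(b_j)$ put $p^A_i(\rho)=\langle a_i|\rho|a_i\rangle$, $p^B_j(\rho)=\langle b_j|\rho|b_j\rangle$ and $p^{AB}(\rho)=p^A(\rho)\otimes p^B(\rho)$. For a set $\mathcal B'$ of states and a family $\mathcal F$ of uncertainty functions, $\rho\in\mathcal B'$ is a universal minimum uncertainty state (universal MUS) within $\mathcal B'$ for $\mathcal F$ if $u(p^{AB}(\rho))\le u(p^{AB}(\sigma))$ for all $u\in\mathcal F$ and all $\sigma\in\mathcal B'$, with strict inequality whenever $u\in\mathcal F$ is strictly Schur-concave and $p^{AB}(\sigma)$ is not a permutation of $p^{AB}(\rho)$. Theorem. Let $\boldsymbol\sigma$ be the vector of Pauli matrices, let $\mathbf a,\mathbf b\in\mathbb R^3$ be unit vectors at angle $\gamma=\pi/4$, let $A=\mathbf a\cdot\boldsymbol\sigma$, $B=\mathbf b\cdot\boldsymbol\sigma$, and let $\epsilon=1/2$. Let $$\rho=\tfrac12\left(\mathbb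 I+\mathbf r\cdot\boldsymbol\sigma\right),\qquad \mathbf r=\pm\tfrac12\,\frac{\mathbf a+\mathbf b}{\|\mathbf a+\mathbf b\|},$$ with either choice of sign. Then $\rho$ is $\epsilon$-pseudo-pure, i.e. $\rho=\epsilon\mathbb I/2+(1-\epsilon)|\psi\rangle\langle\psi|$ for some unit vector $\psi\in\mathbb C^2$, and $\rho$ is a universal MUS within $\mathcal B_2^{\epsilon}$ both for $\mathcal F=\mathcal U$ and for $\mathcal F=\mathcal U_+$. Moreover, $$H_\alpha(p^{AB}(\rho))<H_\alpha(p^{AB}(\sigma))\qquad\text{for all }\alpha\in[-\infty,\infty]$$ and for every $\sigma\in\mathcal B_2^{\epsilon}$ such that $p^{AB}(\sigma)$ is not a permutation of $p^{AB}(\rho)$. -/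

import Mathlib

open scoped Matrix ComplexOrder

noncomputable section

namespace MUS

/-! ### Probability vectors and uncertainty functions -/

/-- The product distribution `p ⊗ q`. -/
def tensor {m n : ℕ} (p : Fin m → ℝ) (q : Fin n → ℝ) : Fin (m * n) → ℝ :=
  fun k => p (finProdFinEquiv.symm k).1 * q (finProdFinEquiv.symm k).2

/-- `q` is obtained from `p` by a permutation of the outcomes. -/
def PermEquiv {d : ℕ} (p q : Fin d → ℝ) : Prop :=
  ∃ π : Equiv.Perm (Fin d), p ∘ π = q

/-- A candidate measure of uncertainty: it assigns a value to every probability vector of every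
dimension. Extended real values are allowed because the Rényi entropies of negative order and the
Burg entropy equal `-∞` on some vectors without full support. Only the values on `stdSimplex` are
ever used. -/
abbrev UncertaintyFunction : Type := (d : ℕ) → (Fin d → ℝ) → EReal

/-- The value is a real number on every probability vector with full support. -/
def IsFinite (u : UncertaintyFunction) : Prop :=
  ∀ (d : ℕ), ∀ p ∈ stdSimplex ℝ (Fin d), (∀ i, 0 < p i) → u d p ≠ ⊥ ∧ u d p ≠ ⊤

/-- Schur-concavity: a bistochastic matrix cannot decrease `u`. -/
def SchurConcave (u : UncertaintyFunction) : Prop :=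
  ∀ (d : ℕ), ∀ p ∈ stdSimplex ℝ (Fin d), ∀ L ∈ doublyStochastic ℝ (Fin d),
    u d p ≤ u d (L *ᵥ p)

/-- Strictness of Schur-concavity on vectors with full support: a bistochastic matrix increases `u`
unless it merely permutes the entries. -/
def StrictlySchurConcave (u : UncertaintyFunction) : Prop :=
  ∀ (d : ℕ), ∀ p ∈ stdSimplex ℝ (Fin d), (∀ i, 0 < p i) → ∀ L ∈ doublyStochastic ℝ (Fin d),
    ¬ PermEquiv p (L *ᵥ p) → u d p < u d (L *ᵥ p)

/-- Additivity for independent random variables. -/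
def Additive (u : UncertaintyFunction) : Prop :=
  ∀ (m n : ℕ), ∀ p ∈ stdSimplex ℝ (Fin m), ∀ q ∈ stdSimplex ℝ (Fin n),
    u (m * n) (tensor p q) = u m p + u n q

/-- On the probability vectors of each dimension, `u` is real-valued and continuous. -/
def RealContinuous (u : UncertaintyFunction) : Prop :=
  ∀ (d : ℕ), ∃ v : (Fin d → ℝ) → ℝ, ContinuousOn v (stdSimplex ℝ (Fin d)) ∧
    ∀ p ∈ stdSimplex ℝ (Fin d), u d p = (v p : EReal)

/-- The family of additive Schur-concave functions. -/
def familyU : Set UncertaintyFunction :=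
  {u | IsFinite u ∧ SchurConcave u ∧ Additive u}

/-- The family of continuous additive Schur-concave functions. -/
def familyUPlus : Set UncertaintyFunction :=
  {u | u ∈ familyU ∧ RealContinuous u}

/-- The Rényi entropy of order `α ∈ [-∞, ∞]` of a probability vector with full support
(for `α = 0` this is the Burg entropy). -/
def renyi {d : ℕ} (α : EReal) (p : Fin d → ℝ) : ℝ :=
  if α = ⊤ then -Real.log (⨆ i, p i)
  else if α = ⊥ then Real.log (⨅ i, p i)
  else if α = 0 then (1 / (d : ℝ)) * ∑ i, Real.log (p i)
  else if α = 1 then -∑ i, p i * Real.log (p i)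
  else Real.sign α.toReal / (1 - α.toReal) * Real.log (∑ i, p i ^ α.toReal)

/-! ### States, measurements, noise -/

/-- The `d`-dimensional quantum states. -/
def states (d : ℕ) : Set (Matrix (Fin d) (Fin d) ℂ) :=
  {ρ | ρ.PosSemidef ∧ ρ.trace = 1}

/-- The noisy states `ε I/d + (1 - ε) ρ`. -/
def noisyStates (d : ℕ) (ε : ℝ) : Set (Matrix (Fin d) (Fin d) ℂ) :=
  {τ | ∃ ρ ∈ states d, τ = ((ε / d : ℝ) : ℂ) • (1 : Matrix (Fin d) (Fin d) ℂ) +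
    ((1 - ε : ℝ) : ℂ) • ρ}

/-- The pseudo-pure states `ε I/d + (1 - ε) |ψ⟩⟨ψ|`. -/
def pseudoPureStates (d : ℕ) (ε : ℝ) : Set (Matrix (Fin d) (Fin d) ℂ) :=
  {τ | ∃ ψ : EuclideanSpace ℂ (Fin d), ‖ψ‖ = 1 ∧
    τ = ((ε / d : ℝ) : ℂ) • (1 : Matrix (Fin d) (Fin d) ℂ) +
      ((1 - ε : ℝ) : ℂ) • Matrix.vecMulVec ψ.ofLp (star ψ.ofLp)}

/-- `e` is an orthonormal basis of eigenvectors of the observable `A`. -/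
def IsEigenbasis {d : ℕ} (A : Matrix (Fin d) (Fin d) ℂ)
    (e : OrthonormalBasis (Fin d) ℂ (EuclideanSpace ℂ (Fin d))) : Prop :=
  ∀ i, ∃ μ : ℂ, A *ᵥ (e i).ofLp = μ • (e i).ofLp

/-- The outcome probabilities `⟨eᵢ|ρ|eᵢ⟩` of the projective measurement in the basis `e`. -/
def outcomeDist {d : ℕ} (e : OrthonormalBasis (Fin d) ℂ (EuclideanSpace ℂ (Fin d)))
    (ρ : Matrix (Fin d) (Fin d) ℂ) : Fin d → ℝ :=
  fun i => (star (e i).ofLp ⬝ᵥ (ρ *ᵥ (e i).ofLp)).re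

/-- The product `pᴬ(ρ) ⊗ pᴮ(ρ)` of the two outcome distributions. -/
def jointDist {d : ℕ} (e f : OrthonormalBasis (Fin d) ℂ (EuclideanSpace ℂ (Fin d)))
    (ρ : Matrix (Fin d) (Fin d) ℂ) : Fin (d * d) → ℝ :=
  tensor (outcomeDist e ρ) (outcomeDist f ρ)

/-- `ρ` is a universal minimum uncertainty state within `S` for the family `F`: every `u ∈ F` is
minimised over `S` at `ρ`, and every `u ∈ F` that is strictly Schur-concave is minimised only there,
up to permutations of the outcomes. (Strictness cannot be asked of every `u`: the zero function and
the Hartley entropy are additive and Schur-concave.) -/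
def IsUniversalMUS {d : ℕ} (F : Set UncertaintyFunction)
    (e f : OrthonormalBasis (Fin d) ℂ (EuclideanSpace ℂ (Fin d)))
    (S : Set (Matrix (Fin d) (Fin d) ℂ)) (ρ : Matrix (Fin d) (Fin d) ℂ) : Prop :=
  ρ ∈ S ∧
  (∀ σ ∈ S, ∀ u ∈ F, u (d * d) (jointDist e f ρ) ≤ u (d * d) (jointDist e f σ)) ∧
  (∀ σ ∈ S, ¬ PermEquiv (jointDist e f ρ) (jointDist e f σ) →
    ∀ u ∈ F, StrictlySchurConcave u →
      u (d * d) (jointDist e f ρ) < u (d * d) (jointDist e f σ))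

/-! ### Qubits -/

/-- The operator `r · σ`, with `σ` the vector of Pauli matrices. -/
def pauliDot (r : EuclideanSpace ℝ (Fin 3)) : Matrix (Fin 2) (Fin 2) ℂ :=
  (r 0 : ℂ) • !![0, 1; 1, 0] + (r 1 : ℂ) • !![0, -Complex.I; Complex.I, 0] +
    (r 2 : ℂ) • !![1, 0; 0, -1]

/-- The operator `(I + r · σ) / 2` with Bloch vector `r`. -/
def blochState (r : EuclideanSpace ℝ (Fin 3)) : Matrix (Fin 2) (Fin 2) ℂ :=
  (1 / 2 : ℂ) • (1 + pauliDot r)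

end MUS

end

/-!
Up to the labelling of the outcomes, a spin measurement along `a` on the state with Bloch vector `n`
has the distribution of a bit with bias `⟪n, a⟫`. The joint distribution is therefore a pair of
independent bits with biases `x = ⟪n, a⟫` and `y = ⟪n, b⟫`, and over the noisy states the pair
`(x, y)` ranges over the ellipse `x ^ 2 + y ^ 2 - √2 * x * y ≤ 1 / 8`. The states with `n = ± r` are
the two vertices `x = y = ± k / 2` on the major axis, where `k = ‖a + b‖ / 2 = cos (π / 8)`.

The distribution at the vertex does not majorize all other ones, but it does so after tensoring with
a suitable catalyst `c` of full support (`exists_isCatalyst_of_mem_ellipse`). For an additive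
Schur-concave `u` the finite number `u c` cancels from `u (p ⊗ c) ≤ u (q ⊗ c)`, which leaves
`u p ≤ u q`; strictness follows because the largest entries of `p ⊗ c` and `q ⊗ c` differ unless
`q` permutes `p`. The Rényi entropies of finite order are sums of a strictly convex function of the
entries, up to monotone reparametrisation, and are handled by the same conversion
(`IsCatalyst.renyi_lt`).

The catalyst is a geometric sequence `(1, r, r ^ 2, …)`, normalised, with `r` close to `1`. By the
theorem of Hardy, Littlewood and Pólya, majorization means domination in the hinge functionals
`∑ (v i - l)⁺`, and for a geometric catalyst these are Riemann sums of
`∫ (v i * w - l)⁺ dw / w`. Hence it suffices that the strict inequality between the integrals holds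
at all thresholds `l` (`exists_isCatalyst_of_sum_upperHinge_lt`). The integrals are explicit:
between consecutive entries, their difference is convex, affine or concave in `l`, and everything reduces
to the ordering of the entries, the comparison of the products of all entries, and one logarithmic
inequality at either end of the spectrum (`upperHinge_fourPoints`, `lowerHinge_fourPoints`).

By symmetry `0 ≤ y ≤ x` may be assumed. Since hinge functionals of a bit increase with its bias, it
suffices to treat the pairs on the arc `x + y = k - 3 * (x - y) ^ 2`, `0 ≤ x - y ≤ 0.15`, which
dominate that part of the ellipse (`exists_curve_ge`). There, the logarithmic inequalities are
equalities to first order in `t = x - y`, and the second-order terms have the right sign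
(`lt_mul_of_le_log`, `mul_lt_of_log_le`).
-/

namespace MUS

/-! ### Majorization and bistochastic matrices -/

/-- Summation by parts, as an inequality: if the partial sums of `d` are nonpositive, replacing
increasing weights by an upper bound `c` can only decrease the weighted sum of `d`. -/
lemma mul_sum_le_sum_mul_of_monotone {n : ℕ} {w d : Fin n → ℝ} {c : ℝ} (hw : Monotone w)
    (hc : ∀ i, w i ≤ c) (hd : ∀ k : Fin n, ∑ i ∈ Finset.Iic k, d i ≤ 0) :
    c * ∑ i, d i ≤ ∑ i, w i * d i := by
  induction n generalizing c with
  | zero => simp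
  | succ n ih =>
    rw [Fin.sum_univ_castSucc, Fin.sum_univ_castSucc]
    have hsum : ∑ i : Fin n, d i.castSucc + d (Fin.last n) ≤ 0 := by
      have h := hd (Fin.last n)
      rwa [show Finset.Iic (Fin.last n) = Finset.univ by ext; simp [Fin.le_last],
        Fin.sum_univ_castSucc] at h
    have h := ih (w := fun i => w i.castSucc) (d := fun i => d i.castSucc) (c := w (Fin.last n))
      (fun i j hij => hw (by simpa using hij)) (fun i => hw (Fin.le_last _)) (fun k => by
        have h := hd k.castSucc
        rwa [← Fin.map_castSuccEmb_Iic, Finset.sum_map] at h)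
    nlinarith [hc (Fin.last n)]

/-- If `q` is dominated by `p` in all hinge functionals, then the smallest entries of `p` sum up to
at most as much as the same number of arbitrary entries of `q`. -/
lemma sum_Iic_le_of_sum_max_le {n : ℕ} {p q : Fin n → ℝ} (hp : Monotone p)
    (hsum : ∑ i, p i = ∑ i, q i)
    (h : ∀ l : ℝ, ∑ i, max (q i - l) 0 ≤ ∑ i, max (p i - l) 0) (k : Fin n) :
    ∑ i ∈ Finset.Iic k, p i ≤ ∑ i ∈ Finset.Iic k, q i := by
  have hmin : ∀ v : Fin n → ℝ, ∑ i, min (v i) (p k) = ∑ i, v i - ∑ i, max (v i - p k) 0 := by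
    intro v
    rw [← Finset.sum_sub_distrib]
    refine Finset.sum_congr rfl fun i _ => ?_
    rcases le_total (v i) (p k) with hv | hv <;> simp [hv]
  have h1 : ∑ i, min (p i) (p k) ≤ ∑ i, min (q i) (p k) := by
    rw [hmin, hmin]
    linarith [h (p k)]
  rw [← Finset.sum_add_sum_compl (Finset.Iic k) fun i => min (p i) (p k),
    ← Finset.sum_add_sum_compl (Finset.Iic k) fun i => min (q i) (p k)] at h1
  have h2 : ∑ i ∈ Finset.Iic k, min (p i) (p k) = ∑ i ∈ Finset.Iic k, p i :=
    Finset.sum_congr rfl fun i hi => min_eq_left (hp (Finset.mem_Iic.1 hi))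
  have h3 : ∑ i ∈ Finset.Iic k, min (q i) (p k) ≤ ∑ i ∈ Finset.Iic k, q i :=
    Finset.sum_le_sum fun i _ => min_le_left _ _
  have h4 : ∑ i ∈ (Finset.Iic k)ᶜ, min (q i) (p k) ≤ ∑ i ∈ (Finset.Iic k)ᶜ, min (p i) (p k) := by
    refine Finset.sum_le_sum fun i hi => ?_
    rw [min_eq_right (hp (le_of_lt (by simpa using hi)))]
    exact min_le_right _ _
  linarith

/-- The vectors `L *ᵥ p`, with `L` bistochastic, form the convex hull of the permutations of `p`
(Birkhoff's theorem). -/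
lemma image_mulVec_doublyStochastic {n : ℕ} (p : Fin n → ℝ) :
    (fun L : Matrix (Fin n) (Fin n) ℝ => L *ᵥ p) '' doublyStochastic ℝ (Fin n) =
      convexHull ℝ (Set.range fun π : Equiv.Perm (Fin n) => p ∘ π) := by
  have h := LinearMap.image_convexHull ((Matrix.mulVecBilin ℝ ℝ).flip p)
    {σ.permMatrix ℝ | σ : Equiv.Perm (Fin n)}
  rw [← doublyStochastic_eq_convexHull_permMatrix] at h
  refine h.trans (congrArg _ ?_)
  rw [← Set.range, ← Set.range_comp]
  exact congrArg Set.range (funext fun π => Matrix.permMatrix_mulVec _)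

/-- The Hardy–Littlewood–Pólya theorem: domination in all hinge functionals
`v ↦ ∑ i, (v i - l)⁺` gives a bistochastic matrix. A vector outside the convex hull of the
permutations of `p` would be separated from it by a linear functional, and the rearrangement that
sorts `p` along that functional contradicts the separation. -/
theorem exists_doublyStochastic_of_sum_max_le {n : ℕ} {p q : Fin n → ℝ}
    (hsum : ∑ i, p i = ∑ i, q i)
    (h : ∀ l : ℝ, ∑ i, max (q i - l) 0 ≤ ∑ i, max (p i - l) 0) :
    ∃ L ∈ doublyStochastic ℝ (Fin n), L *ᵥ p = q := by
  change q ∈ (fun L : Matrix (Fin n) (Fin n) ℝ => L *ᵥ p) '' doublyStochastic ℝ (Fin n)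
  rw [image_mulVec_doublyStochastic]
  by_contra hq
  obtain ⟨f, u, hf, hu⟩ := geometric_hahn_banach_closed_point (convex_convexHull ℝ _)
    ((Set.finite_range fun π : Equiv.Perm (Fin n) => p ∘ π).isClosed_convexHull ℝ) hq
  set w : Fin n → ℝ := fun i => f (Pi.single i 1) with hw
  have hfw : ∀ v, f v = ∑ i, w i * v i := by
    intro v
    conv_lhs => rw [pi_eq_sum_univ' v]
    simp only [map_sum, map_smul, smul_eq_mul, hw]
    refine Finset.sum_congr rfl fun i _ => ?_
    rw [mul_comm]
  set τ := Tuple.sort w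
  set ρ := Tuple.sort p
  have hpq : f q ≤ f (p ∘ (τ.symm.trans ρ)) := by
    rw [hfw, hfw, ← Equiv.sum_comp τ, ← Equiv.sum_comp τ fun i => w i * _, ← sub_nonneg,
      ← Finset.sum_sub_distrib]
    have hτ : ∑ i, q (τ i) = ∑ i, p (ρ i) := by rw [Equiv.sum_comp, Equiv.sum_comp, hsum]
    rcases n.eq_zero_or_pos with rfl | hn
    · simp
    have h0 := mul_sum_le_sum_mul_of_monotone (w := w ∘ τ) (d := fun i => p (ρ i) - q (τ i))
      (c := (w ∘ τ) ⟨n - 1, by omega⟩) (Tuple.monotone_sort w)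
      (fun i => Tuple.monotone_sort w (Fin.mk_le_mk.2 (by omega))) (fun k => by
        rw [Finset.sum_sub_distrib, sub_nonpos]
        refine sum_Iic_le_of_sum_max_le (p := p ∘ ρ) (q := q ∘ τ) (Tuple.monotone_sort p)
          hτ.symm (fun l => ?_) k
        have e1 := Equiv.sum_comp τ fun i => max (q i - l) 0
        have e2 := Equiv.sum_comp ρ fun i => max (p i - l) 0
        simp only [Function.comp_apply]
        rw [e1, e2]
        exact h l)
    rw [Finset.sum_sub_distrib, hτ, sub_self, mul_zero] at h0
    refine h0.trans (le_of_eq (Finset.sum_congr rfl fun i _ => ?_))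
    simp [mul_sub]
  linarith [hf _ (subset_convexHull ℝ _ ⟨τ.symm.trans ρ, rfl⟩)]

/-- A bistochastic matrix strictly decreases a sum of strictly convex functions unless it permutes
the entries: a point where the sum takes its maximal value over the convex hull of the permutations
of `p` is an extreme point of the hull. -/
lemma sum_lt_sum_of_strictConvexOn {n : ℕ} {f : ℝ → ℝ} (hf : StrictConvexOn ℝ (Set.Ioi 0) f)
    {p : Fin n → ℝ} (hp : ∀ i, 0 < p i) {L : Matrix (Fin n) (Fin n) ℝ}
    (hL : L ∈ doublyStochastic ℝ (Fin n)) (hLp : ¬ PermEquiv p (L *ᵥ p)) :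
    ∑ i, f ((L *ᵥ p) i) < ∑ i, f (p i) := by
  set O := Set.range fun π : Equiv.Perm (Fin n) => p ∘ π with hO
  set P : Set (Fin n → ℝ) := Set.univ.pi fun _ => Set.Ioi 0 with hP
  have hconv : StrictConvexOn ℝ P fun v => ∑ i, f (v i) := by
    refine ⟨convex_pi fun i _ => convex_Ioi 0, fun x hx y hy hxy a b ha hb hab => ?_⟩
    obtain ⟨j, hj⟩ := Function.ne_iff.1 hxy
    simp only [smul_eq_mul, Finset.mul_sum, ← Finset.sum_add_distrib, Pi.add_apply, Pi.smul_apply]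
    exact Finset.sum_lt_sum
      (fun i _ => hf.convexOn.2 (hx i trivial) (hy i trivial) ha.le hb.le hab)
      ⟨j, Finset.mem_univ j, hf.2 (hx j trivial) (hy j trivial) hj ha hb hab⟩
  have hOT : convexHull ℝ O ⊆ {v ∈ P | ∑ i, f (v i) ≤ ∑ i, f (p i)} := by
    refine convexHull_min ?_ (hconv.convexOn.convex_le _)
    rintro _ ⟨π, rfl⟩
    exact ⟨fun i _ => hp _, (Equiv.sum_comp π fun i => f (p i)).le⟩
  have hmem : L *ᵥ p ∈ convexHull ℝ O := by
    rw [hO, ← image_mulVec_doublyStochastic]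
    exact ⟨L, hL, rfl⟩
  refine lt_of_le_of_ne (hOT hmem).2 fun heq => hLp ?_
  refine extremePoints_convexHull_subset (𝕜 := ℝ) (A := O) (mem_extremePoints.2 ⟨hmem, ?_⟩)
  intro x hx y hy hxy
  by_cases hne : x = y
  · subst hne
    simpa [openSegment_same, eq_comm] using hxy
  · have h1 := hconv.lt_on_openSegment (hOT hx).1 (hOT hy).1 hne hxy
    rw [heq] at h1
    exact absurd h1 (not_lt.2 (max_le (hOT hx).2 (hOT hy).2))

/-! ### Catalytic majorization -/

/-- `c` is a catalyst for the conversion of `p` into `q`: it is a probability vector with full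
support such that `p ⊗ c` majorizes `q ⊗ c`, majorization being expressed through the hinge
functionals `v ↦ ∑ i, (v i - l)⁺`. -/
def IsCatalyst {d n : ℕ} (c : Fin n → ℝ) (p q : Fin d → ℝ) : Prop :=
  c ∈ stdSimplex ℝ (Fin n) ∧ (∀ j, 0 < c j) ∧
    ∀ l : ℝ, ∑ i, ∑ j, max (q i * c j - l) 0 ≤ ∑ i, ∑ j, max (p i * c j - l) 0

lemma sum_tensor {m n : ℕ} (p : Fin m → ℝ) (q : Fin n → ℝ) (g : ℝ → ℝ) :
    ∑ k, g (tensor p q k) = ∑ i, ∑ j, g (p i * q j) := by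
  rw [← Fintype.sum_prod_type' fun i j => g (p i * q j)]
  exact Equiv.sum_comp finProdFinEquiv.symm fun x => g (p x.1 * q x.2)

lemma tensor_mem_stdSimplex {m n : ℕ} {p : Fin m → ℝ} {q : Fin n → ℝ}
    (hp : p ∈ stdSimplex ℝ (Fin m)) (hq : q ∈ stdSimplex ℝ (Fin n)) :
    tensor p q ∈ stdSimplex ℝ (Fin (m * n)) := by
  refine ⟨fun k => mul_nonneg (hp.1 _) (hq.1 _), ?_⟩
  rw [sum_tensor p q fun x => x, ← Finset.sum_mul_sum, hp.2, hq.2, one_mul]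

lemma tensor_pos {m n : ℕ} {p : Fin m → ℝ} {q : Fin n → ℝ} (hp : ∀ i, 0 < p i)
    (hq : ∀ i, 0 < q i) (k : Fin (m * n)) : 0 < tensor p q k :=
  mul_pos (hp _) (hq _)

namespace IsCatalyst

variable {d n : ℕ} {c : Fin n → ℝ} {p q : Fin d → ℝ}

lemma exists_doublyStochastic (h : IsCatalyst c p q) (hpq : ∑ i, p i = ∑ i, q i) :
    ∃ L ∈ doublyStochastic ℝ (Fin (d * n)), L *ᵥ tensor p c = tensor q c := by
  refine exists_doublyStochastic_of_sum_max_le ?_ fun l => ?_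
  · rw [sum_tensor p c fun x => x, sum_tensor q c fun x => x, ← Finset.sum_mul_sum,
      ← Finset.sum_mul_sum, hpq]
  · rw [sum_tensor p c fun x => max (x - l) 0, sum_tensor q c fun x => max (x - l) 0]
    exact h.2.2 l

/-- If the largest entry of `p` exceeds that of `q`, then `p ⊗ c` and `q ⊗ c` are not permutations
of each other. -/
lemma not_permEquiv_tensor (h : IsCatalyst c p q) (hq : ∀ i, 0 < q i)
    (hmax : ∃ i, ∀ j, q j < p i) : ¬ PermEquiv (tensor p c) (tensor q c) := by
  rintro ⟨π, hπ⟩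
  obtain ⟨i, hi⟩ := hmax
  have : Nonempty (Fin n) := by
    by_contra hn
    rw [not_nonempty_iff] at hn
    simpa using h.1.2
  obtain ⟨k, hk⟩ := Finite.exists_max c
  have h1 := congrFun hπ (π.symm (finProdFinEquiv (i, k)))
  rw [Function.comp_apply, Equiv.apply_symm_apply] at h1
  simp only [tensor, Equiv.symm_apply_apply] at h1
  have h2 := mul_lt_mul_of_pos_right (hi (finProdFinEquiv.symm (π.symm (finProdFinEquiv (i, k)))).1)
    (h.2.1 k)
  have h3 := mul_le_mul_of_nonneg_left
    (hk (finProdFinEquiv.symm (π.symm (finProdFinEquiv (i, k)))).2)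
    (hq (finProdFinEquiv.symm (π.symm (finProdFinEquiv (i, k)))).1).le
  linarith

/-- An additive Schur-concave function cannot decrease under a catalytic conversion: the finite
value on the catalyst cancels. -/
lemma le_of_mem_familyU (h : IsCatalyst c p q) (hp : p ∈ stdSimplex ℝ (Fin d))
    (hq : q ∈ stdSimplex ℝ (Fin d)) {u : UncertaintyFunction} (hu : u ∈ familyU) :
    u d p ≤ u d q := by
  obtain ⟨L, hL, hLp⟩ := h.exists_doublyStochastic (hp.2.trans hq.2.symm)
  have h1 := hu.2.1 _ _ (tensor_mem_stdSimplex hp h.1) L hL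
  rw [hLp, hu.2.2 _ _ p hp c h.1, hu.2.2 _ _ q hq c h.1] at h1
  have hc := hu.1 n c h.1 h.2.1
  lift u n c to ℝ using ⟨hc.2, hc.1⟩ with z
  exact le_of_not_gt fun hlt => absurd h1 (not_le.2 (EReal.add_lt_add_right_coe hlt z))

lemma lt_of_mem_familyU (h : IsCatalyst c p q) (hp : p ∈ stdSimplex ℝ (Fin d))
    (hq : q ∈ stdSimplex ℝ (Fin d)) (hp0 : ∀ i, 0 < p i) (hq0 : ∀ i, 0 < q i)
    (hmax : ∃ i, ∀ j, q j < p i) {u : UncertaintyFunction} (hu : u ∈ familyU)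
    (hus : StrictlySchurConcave u) : u d p < u d q := by
  obtain ⟨L, hL, hLp⟩ := h.exists_doublyStochastic (hp.2.trans hq.2.symm)
  have h1 := hus _ _ (tensor_mem_stdSimplex hp h.1) (tensor_pos hp0 h.2.1) L hL
    (hLp ▸ h.not_permEquiv_tensor hq0 hmax)
  rw [hLp, hu.2.2 _ _ p hp c h.1, hu.2.2 _ _ q hq c h.1] at h1
  exact lt_of_not_ge fun hle => absurd h1 (not_lt.2 (add_le_add_left hle _))

lemma sum_lt_sum (h : IsCatalyst c p q) (hpq : ∑ i, p i = ∑ i, q i) (hp0 : ∀ i, 0 < p i)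
    (hq0 : ∀ i, 0 < q i) (hmax : ∃ i, ∀ j, q j < p i) {f : ℝ → ℝ}
    (hf : StrictConvexOn ℝ (Set.Ioi 0) f) :
    ∑ i, ∑ j, f (q i * c j) < ∑ i, ∑ j, f (p i * c j) := by
  obtain ⟨L, hL, hLp⟩ := h.exists_doublyStochastic hpq
  have h1 := sum_lt_sum_of_strictConvexOn hf (tensor_pos hp0 h.2.1) hL
    (hLp ▸ h.not_permEquiv_tensor hq0 hmax)
  rwa [hLp, sum_tensor, sum_tensor] at h1

end IsCatalyst

/-! ### Rényi entropies -/

lemma sum_sum_mul_rpow {d n : ℕ} {p : Fin d → ℝ} {c : Fin n → ℝ} (hp : ∀ i, 0 < p i)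
    (hc : ∀ j, 0 < c j) (a : ℝ) :
    ∑ i, ∑ j, (p i * c j) ^ a = (∑ i, p i ^ a) * ∑ j, c j ^ a := by
  rw [Finset.sum_mul_sum]
  exact Finset.sum_congr rfl fun i _ => Finset.sum_congr rfl fun j _ =>
    Real.mul_rpow (hp i).le (hc j).le

lemma strictConvexOn_rpow_of_neg {a : ℝ} (ha : a < 0) :
    StrictConvexOn ℝ (Set.Ioi 0) fun x : ℝ => x ^ a := by
  refine strictConvexOn_of_deriv2_pos' (convex_Ioi 0)
    (fun x hx => (Real.continuousAt_rpow_const _ _ (Or.inl (ne_of_gt hx))).continuousWithinAt)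
    fun x hx => ?_
  rw [Real.iter_deriv_rpow_const]
  have h : (descPochhammer ℝ 2).eval a = a * (a - 1) := by simp [descPochhammer_succ_right]
  rw [h]
  exact mul_pos (mul_pos_of_neg_of_neg ha (by linarith)) (Real.rpow_pos_of_pos hx _)

/-- A catalytic conversion strictly increases all Rényi entropies. For finite orders this is
strict convexity of `x ↦ x ^ α`, `-log x` or `x * log x` together with additivity; the two
infinite orders only see the extreme entries. -/
lemma IsCatalyst.renyi_lt {d n : ℕ} {c : Fin n → ℝ} {p q : Fin d → ℝ} (h : IsCatalyst c p q)
    (hp : p ∈ stdSimplex ℝ (Fin d)) (hq : q ∈ stdSimplex ℝ (Fin d)) (hp0 : ∀ i, 0 < p i)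
    (hq0 : ∀ i, 0 < q i) (hmax : ∃ i, ∀ j, q j < p i) (hmin : ∃ i, ∀ j, p i < q j) (α : EReal) :
    renyi α p < renyi α q := by
  obtain ⟨i₀, hi₀⟩ := hmax
  have : Nonempty (Fin d) := ⟨i₀⟩
  have hpq := hp.2.trans hq.2.symm
  have hd : 0 < (d : ℝ) := by exact_mod_cast Fin.pos i₀
  have key {f : ℝ → ℝ} (hf : StrictConvexOn ℝ (Set.Ioi 0) f) :=
    h.sum_lt_sum hpq hp0 hq0 ⟨i₀, hi₀⟩ hf
  have hn : 0 < (n : ℝ) := by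
    rcases n.eq_zero_or_pos with rfl | hn
    · simpa using h.1.2
    · exact_mod_cast hn
  have : Nonempty (Fin n) := ⟨⟨0, by exact_mod_cast hn⟩⟩
  unfold renyi
  split_ifs with h1 h2 h3 h4
  · -- `α = ⊤`
    obtain ⟨j, hj⟩ := exists_eq_ciSup_of_finite (f := q)
    rw [← hj]
    exact neg_lt_neg (Real.log_lt_log (hq0 j)
      ((hi₀ j).trans_le (le_ciSup (Set.finite_range p).bddAbove i₀)))
  · -- `α = ⊥`
    obtain ⟨i₁, hi₁⟩ := hmin
    obtain ⟨j, hj⟩ := exists_eq_ciInf_of_finite (f := q)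
    obtain ⟨k, hk⟩ := exists_eq_ciInf_of_finite (f := p)
    have hle := ciInf_le (Set.finite_range p).bddBelow i₁
    rw [← hk] at hle
    rw [← hj, ← hk]
    exact Real.log_lt_log (hp0 k) (hle.trans_lt (hi₁ j))
  · -- `α = 0`
    have h5 := key strictConcaveOn_log_Ioi.neg
    have e : ∀ v : Fin d → ℝ, (∀ i, 0 < v i) → ∑ i, ∑ j, (-Real.log) (v i * c j) =
        -(n * ∑ i, Real.log (v i) + d * ∑ j, Real.log (c j)) := by
      intro v hv
      have : ∀ i j, (-Real.log) (v i * c j) = -(Real.log (v i) + Real.log (c j)) := fun i j => by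
        rw [Pi.neg_apply, Real.log_mul (hv i).ne' (h.2.1 j).ne']
      simp_rw [this, Finset.sum_neg_distrib, Finset.sum_add_distrib, Finset.sum_const,
        Finset.card_univ, Fintype.card_fin, nsmul_eq_mul, Finset.mul_sum]
    rw [e q hq0, e p hp0, neg_lt_neg_iff, add_lt_add_iff_right, mul_lt_mul_iff_right₀ hn] at h5
    exact mul_lt_mul_of_pos_left h5 (by positivity)
  · -- `α = 1`
    have h5 := key (Real.strictConvexOn_mul_log.subset Set.Ioi_subset_Ici_self (convex_Ioi 0))
    have e : ∀ v : Fin d → ℝ, (∀ i, 0 < v i) → ∑ i, v i = 1 →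
        ∑ i, ∑ j, v i * c j * Real.log (v i * c j) =
        ∑ i, v i * Real.log (v i) + ∑ j, c j * Real.log (c j) := by
      intro v hv hv1
      have : ∀ i j, v i * c j * Real.log (v i * c j) =
          v i * Real.log (v i) * c j + v i * (c j * Real.log (c j)) := fun i j => by
        rw [Real.log_mul (hv i).ne' (h.2.1 j).ne']
        ring
      simp_rw [this, Finset.sum_add_distrib, ← Finset.mul_sum, ← Finset.sum_mul, h.1.2, hv1,
        one_mul, mul_one]
    rw [e q hq0 hq.2, e p hp0 hp.2] at h5
    linarith
  · lift α to ℝ using ⟨h1, h2⟩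
    rw [EReal.toReal_coe]
    have hα0 : α ≠ 0 := by exact_mod_cast h3
    have hα1 : α ≠ 1 := by exact_mod_cast h4
    have hsum : ∀ {m : ℕ} [Nonempty (Fin m)] {v : Fin m → ℝ}, (∀ i, 0 < v i) →
        0 < ∑ i, v i ^ α := fun hv =>
      Finset.sum_pos (fun i _ => Real.rpow_pos_of_pos (hv i) α) Finset.univ_nonempty
    have hc := hsum h.2.1
    have hlt (hf : StrictConvexOn ℝ (Set.Ioi 0) fun x : ℝ => x ^ α) :
        Real.log (∑ i, q i ^ α) < Real.log (∑ i, p i ^ α) := by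
      have h5 := key hf
      rw [sum_sum_mul_rpow hq0 h.2.1, sum_sum_mul_rpow hp0 h.2.1, mul_lt_mul_iff_left₀ hc] at h5
      exact Real.log_lt_log (hsum hq0) h5
    rcases lt_or_gt_of_ne hα0 with hneg | hpos
    · rw [Real.sign_of_neg hneg]
      exact mul_lt_mul_of_neg_left (hlt (strictConvexOn_rpow_of_neg hneg))
        (div_neg_of_neg_of_pos (by norm_num) (by linarith))
    rw [Real.sign_of_pos hpos]
    rcases lt_or_gt_of_ne hα1 with hlt1 | hgt1
    · have h5 := key (f := -fun x : ℝ => x ^ α) ((Real.strictConcaveOn_rpow hpos hlt1).subset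
        Set.Ioi_subset_Ici_self (convex_Ioi 0)).neg
      simp only [Pi.neg_apply, Finset.sum_neg_distrib] at h5
      rw [sum_sum_mul_rpow hq0 h.2.1, sum_sum_mul_rpow hp0 h.2.1, neg_lt_neg_iff,
        mul_lt_mul_iff_left₀ hc] at h5
      exact mul_lt_mul_of_pos_left (Real.log_lt_log (hsum hp0) h5)
        (div_pos one_pos (by linarith))
    · exact mul_lt_mul_of_neg_left (hlt ((strictConvexOn_rpow hgt1).subset
        Set.Ioi_subset_Ici_self (convex_Ioi 0))) (div_neg_of_pos_of_neg one_pos (by linarith))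

/-! ### Geometric catalysts -/

/-- The integral `∫ (z * w - l)⁺ dw / w` over `w ∈ (0, 1]`, in closed form. -/
noncomputable def upperHinge (z l : ℝ) : ℝ := max z l - l - l * Real.log (max z l / l)

/-- The integral `∫ (l - z * w)⁺ dw / w` over `w ∈ [1, ∞)`, in closed form. -/
noncomputable def lowerHinge (z l : ℝ) : ℝ := min z l - l - l * Real.log (min z l / l)

lemma upperHinge_of_le {z l : ℝ} (hl : 0 < l) (h : z ≤ l) : upperHinge z l = 0 := by
  simp [upperHinge, max_eq_right h, div_self hl.ne']

lemma upperHinge_of_ge {z l : ℝ} (h : l ≤ z) : upperHinge z l = z - l - l * Real.log (z / l) := by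
  simp [upperHinge, max_eq_left h]

lemma lowerHinge_of_ge {z l : ℝ} (hl : 0 < l) (h : l ≤ z) : lowerHinge z l = 0 := by
  simp [lowerHinge, min_eq_right h, div_self hl.ne']

lemma lowerHinge_of_le {z l : ℝ} (h : z ≤ l) : lowerHinge z l = z - l - l * Real.log (z / l) := by
  simp [lowerHinge, min_eq_left h]

lemma upperHinge_add_lowerHinge {z l : ℝ} (hl : 0 < l) :
    upperHinge z l + lowerHinge z l = z - l - l * Real.log (z / l) := by
  rcases le_total z l with h | h
  · rw [upperHinge_of_le hl h, lowerHinge_of_le h, zero_add]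
  · rw [lowerHinge_of_ge hl h, upperHinge_of_ge h, add_zero]

lemma lowerHinge_mul {k z l : ℝ} (hk : 0 < k) :
    lowerHinge (k * z) l = k * lowerHinge z (l / k) := by
  have h : min (k * z) l = k * min z (l / k) := by
    rw [mul_min_of_nonneg _ _ hk.le, mul_div_cancel₀ _ hk.ne']
  have h2 : k * min z (l / k) / l = min z (l / k) / (l / k) := by field_simp
  rw [lowerHinge, lowerHinge, h, h2]
  field_simp

lemma continuousOn_upperHinge {z : ℝ} : ContinuousOn (upperHinge z) (Set.Ioi 0) := by
  unfold upperHinge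
  refine ContinuousOn.sub (by fun_prop) (continuousOn_id.mul (ContinuousOn.log ?_ ?_))
  · exact ContinuousOn.div (by fun_prop) continuousOn_id fun l hl => ne_of_gt hl
  · intro l (hl : 0 < l)
    exact (div_pos (lt_max_of_lt_right hl) hl).ne'

lemma sub_le_mul_log {a b : ℝ} (ha : 0 < a) (hb : 0 < b) : a - b ≤ a * Real.log (a / b) := by
  have h := Real.one_sub_inv_le_log_of_pos (div_pos ha hb)
  rw [inv_div] at h
  have h2 := mul_le_mul_of_nonneg_left h ha.le
  rwa [mul_sub, mul_one, mul_div_cancel₀ _ ha.ne'] at h2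

lemma mul_log_le_sub {a b : ℝ} (ha : 0 < a) (hb : 0 < b) : b * Real.log (a / b) ≤ a - b := by
  have h := sub_le_mul_log hb ha
  rw [← inv_div, Real.log_inv] at h
  linarith

lemma upperHinge_nonneg {z l : ℝ} (hl : 0 < l) : 0 ≤ upperHinge z l := by
  rcases le_total z l with h | h
  · rw [upperHinge_of_le hl h]
  · rw [upperHinge_of_ge h]
    linarith [mul_log_le_sub (hl.trans_le h) hl]

/-- The right endpoint bound for the integral of `(w - l)⁺ dw / w` over `[y, z]`. -/
lemma upperHinge_sub_le {y z l : ℝ} (hl : 0 < l) (hy : 0 < y) (hyz : y ≤ z) :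
    upperHinge z l - upperHinge y l ≤ Real.log (z / y) * max (z - l) 0 := by
  have hz := hy.trans_le hyz
  rcases le_total z l with h | h
  · rw [upperHinge_of_le hl h, upperHinge_of_le hl (hyz.trans h), max_eq_right (by linarith)]
    simp
  rw [upperHinge_of_ge h, max_eq_left (by linarith)]
  rcases le_total y l with h' | h'
  · rw [upperHinge_of_le hl h']
    have h1 := sub_le_mul_log hz hl
    have h2 : Real.log (z / l) ≤ Real.log (z / y) := Real.log_le_log (by positivity) (by gcongr)
    nlinarith
  · rw [upperHinge_of_ge h']
    have h1 := sub_le_mul_log hz hy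
    rw [Real.log_div hz.ne' hl.ne', Real.log_div hy.ne' hl.ne']
    rw [Real.log_div hz.ne' hy.ne'] at h1 ⊢
    linarith

/-- The left endpoint bound for the integral of `(w - l)⁺ dw / w` over `[y, z]`. -/
lemma le_upperHinge_sub {y z l : ℝ} (hl : 0 < l) (hy : 0 < y) (hyz : y ≤ z) :
    Real.log (z / y) * max (y - l) 0 ≤ upperHinge z l - upperHinge y l := by
  have hz := hy.trans_le hyz
  rcases le_total y l with h' | h'
  · rw [upperHinge_of_le hl h', max_eq_right (by linarith)]
    simpa using upperHinge_nonneg hl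
  · rw [upperHinge_of_ge h', upperHinge_of_ge (h'.trans hyz), max_eq_left (by linarith)]
    have h1 := mul_log_le_sub hz hy
    rw [Real.log_div hz.ne' hl.ne', Real.log_div hy.ne' hl.ne']
    rw [Real.log_div hz.ne' hy.ne'] at h1 ⊢
    linarith

lemma upperHinge_sub_le_sum {z l t : ℝ} (hl : 0 < l) (hz : 0 < z) (ht : 0 < t) (n : ℕ) :
    upperHinge z l - upperHinge (z * Real.exp (-t) ^ n) l ≤
      t * ∑ j ∈ Finset.range n, max (z * Real.exp (-t) ^ j - l) 0 := by
  induction n with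
  | zero => simp
  | succ n ih =>
    have hr : 0 < z * Real.exp (-t) ^ n := by positivity
    have h := upperHinge_sub_le (y := z * Real.exp (-t) ^ (n + 1)) hl (by positivity)
      (mul_le_mul_of_nonneg_left (pow_le_pow_of_le_one (Real.exp_pos _).le
        (Real.exp_le_one_iff.2 (by linarith)) n.le_succ) hz.le)
    rw [show z * Real.exp (-t) ^ n / (z * Real.exp (-t) ^ (n + 1)) = Real.exp t by
      rw [pow_succ, ← mul_assoc, div_mul_cancel_left₀ hr.ne', Real.exp_neg, inv_inv],
      Real.log_exp] at h
    rw [Finset.sum_range_succ, mul_add]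
    linarith

lemma sum_le_upperHinge_sub {z l t : ℝ} (hl : 0 < l) (hz : 0 < z) (ht : 0 < t) (n : ℕ) :
    t * ∑ j ∈ Finset.range n, max (z * Real.exp (-t) ^ j - l) 0 ≤
      upperHinge z l - upperHinge (z * Real.exp (-t) ^ n) l +
        t * (max (z - l) 0 - max (z * Real.exp (-t) ^ n - l) 0) := by
  induction n with
  | zero => simp
  | succ n ih =>
    have hr : 0 < z * Real.exp (-t) ^ n := by positivity
    have h := le_upperHinge_sub (y := z * Real.exp (-t) ^ (n + 1)) hl (by positivity)
      (mul_le_mul_of_nonneg_left (pow_le_pow_of_le_one (Real.exp_pos _).le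
        (Real.exp_le_one_iff.2 (by linarith)) n.le_succ) hz.le)
    rw [show z * Real.exp (-t) ^ n / (z * Real.exp (-t) ^ (n + 1)) = Real.exp t by
      rw [pow_succ, ← mul_assoc, div_mul_cancel_left₀ hr.ne', Real.exp_neg, inv_inv],
      Real.log_exp] at h
    rw [Finset.sum_range_succ, mul_add]
    linarith

/-- The vector proportional to `(1, r, r², …)`, `r = exp (-t)`, catalyses `p → q` as soon as `t` is
small and the continuous analogue of the majorization condition holds strictly. Compactness of the
relevant range of thresholds makes the analogue hold with a uniform margin, which absorbs the
error of the Riemann sums. -/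
lemma exists_isCatalyst_of_sum_upperHinge_lt {d : ℕ} {p q : Fin d → ℝ} {k a b : ℝ}
    (hp0 : ∀ i, 0 < p i) (hq0 : ∀ i, 0 < q i) (hp : ∑ i, p i = 1) (hq : ∑ i, q i = 1)
    (hk0 : 0 < k) (hk1 : k < 1) (ha : 0 < a) (haq : ∀ i, a ≤ q i) (hqb : ∀ i, q i ≤ b)
    (h : ∀ l, k * a ≤ l → l ≤ b → ∑ i, (upperHinge (q i) l - upperHinge (q i * k) l) <
      ∑ i, (upperHinge (p i) l - upperHinge (p i * k) l)) :
    ∃ (n : ℕ) (c : Fin n → ℝ), IsCatalyst c p q := by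
  obtain ⟨δ, hδ, hδl⟩ : ∃ δ > 0, ∀ l, k * a ≤ l → l ≤ b →
      δ ≤ ∑ i, (upperHinge (p i) l - upperHinge (p i * k) l) -
        ∑ i, (upperHinge (q i) l - upperHinge (q i * k) l) := by
    rcases (Set.Icc (k * a) b).eq_empty_or_nonempty with he | hne
    · refine ⟨1, one_pos, fun l h1 h2 => ?_⟩
      exact absurd (h1.trans h2) (Set.Icc_eq_empty_iff.1 he)
    · have hsub : Set.Icc (k * a) b ⊆ Set.Ioi 0 := fun l hl => (mul_pos hk0 ha).trans_le hl.1
      have hc : ContinuousOn (fun l => ∑ i, (upperHinge (p i) l - upperHinge (p i * k) l) -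
          ∑ i, (upperHinge (q i) l - upperHinge (q i * k) l)) (Set.Icc (k * a) b) := by
        refine ContinuousOn.sub ?_ ?_ <;>
        exact continuousOn_finsetSum _ fun i _ =>
          (continuousOn_upperHinge.mono hsub).sub (continuousOn_upperHinge.mono hsub)
      obtain ⟨l₀, hl₀, hmin⟩ := isCompact_Icc.exists_isMinOn hne hc
      exact ⟨_, sub_pos.2 (h l₀ hl₀.1 hl₀.2), fun l h1 h2 => hmin ⟨h1, h2⟩⟩
  have hlog : 0 < -Real.log k := neg_pos.2 (Real.log_neg hk0 hk1)
  obtain ⟨n, hn⟩ := exists_nat_gt (-Real.log k / δ)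
  have hn0 : (0 : ℝ) < n := (div_pos hlog hδ).trans hn
  set t := -Real.log k / n with ht
  have ht0 : 0 < t := div_pos hlog hn0
  have htδ : t ≤ δ := by
    rw [ht, div_le_iff₀ hn0]
    rw [div_lt_iff₀ hδ] at hn
    linarith
  set r := Real.exp (-t) with hr
  have hr0 : 0 < r := Real.exp_pos _
  have hr1 : r ≤ 1 := Real.exp_le_one_iff.2 (by linarith)
  have hrn : r ^ n = k := by
    rw [hr, ← Real.exp_nat_mul, ht, show (n : ℝ) * -(-Real.log k / n) = Real.log k by field_simp,
      Real.exp_log hk0]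
  have hrk : ∀ j < n, k ≤ r ^ j := fun j hj =>
    hrn ▸ pow_le_pow_of_le_one hr0.le hr1 hj.le
  -- domination in all hinge functionals for the unnormalised catalyst
  have main : ∀ l : ℝ, ∑ i, ∑ j ∈ Finset.range n, max (q i * r ^ j - l) 0 ≤
      ∑ i, ∑ j ∈ Finset.range n, max (p i * r ^ j - l) 0 := by
    intro l
    -- below `k * a` the hinges of `q` are affine, above `b` they vanish; both cases are trivial
    rcases le_total l (k * a) with h1 | h1
    · calc _ = ∑ i, ∑ j ∈ Finset.range n, (q i * r ^ j - l) := by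
            refine Finset.sum_congr rfl fun i _ => Finset.sum_congr rfl fun j hj => max_eq_left ?_
            have := mul_le_mul (haq i) (hrk j (Finset.mem_range.1 hj)) hk0.le (hq0 i).le
            linarith
        _ = ∑ i, ∑ j ∈ Finset.range n, (p i * r ^ j - l) := by
            simp only [Finset.sum_sub_distrib]
            rw [← Finset.sum_mul_sum, ← Finset.sum_mul_sum, hp, hq]
        _ ≤ _ := Finset.sum_le_sum fun i _ => Finset.sum_le_sum fun j _ => le_max_left _ _
    have hl : 0 < l := (mul_pos hk0 ha).trans_le h1
    rcases le_total b l with h2 | h2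
    · refine Finset.sum_le_sum fun i _ => Finset.sum_le_sum fun j _ => ?_
      refine (max_eq_right ?_).trans_le (le_max_right _ _)
      have := mul_le_mul (hqb i) (pow_le_one₀ (n := j) hr0.le hr1) (by positivity)
        ((hq0 i).le.trans (hqb i))
      linarith
    refine le_of_mul_le_mul_left ?_ ht0
    simp only [Finset.mul_sum (Finset.univ)]
    have hub : ∑ i, t * ∑ j ∈ Finset.range n, max (q i * r ^ j - l) 0 ≤
        ∑ i, (upperHinge (q i) l - upperHinge (q i * k) l + t * q i) := by
      refine Finset.sum_le_sum fun i _ => ?_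
      have h3 := sum_le_upperHinge_sub hl (hq0 i) ht0 n
      rw [← hr, hrn] at h3
      refine h3.trans (add_le_add le_rfl (mul_le_mul_of_nonneg_left ?_ ht0.le))
      have h4 : max (q i - l) 0 ≤ q i := max_le (by linarith) (hq0 i).le
      have h5 : 0 ≤ max (q i * k - l) 0 := le_max_right _ _
      linarith
    have hlb : ∑ i, (upperHinge (p i) l - upperHinge (p i * k) l) ≤
        ∑ i, t * ∑ j ∈ Finset.range n, max (p i * r ^ j - l) 0 := by
      refine Finset.sum_le_sum fun i _ => ?_
      have h3 := upperHinge_sub_le_sum hl (hp0 i) ht0 n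
      rwa [← hr, hrn] at h3
    rw [Finset.sum_add_distrib, ← Finset.mul_sum (f := q), hq] at hub
    linarith [hδl l h1 h2]
  set Z := ∑ j ∈ Finset.range n, r ^ j with hZ
  have hZ0 : 0 < Z := Finset.sum_pos (fun j _ => pow_pos hr0 j)
    (Finset.nonempty_range_iff.2 (by rintro rfl; simp at hn0))
  refine ⟨n, fun j => r ^ (j : ℕ) / Z, ⟨fun j => by positivity, ?_⟩, fun j => by positivity,
    fun l => ?_⟩
  · rw [← Finset.sum_div, Fin.sum_univ_eq_sum_range (fun j => r ^ j), div_self hZ0.ne']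
  · have e : ∀ v : Fin d → ℝ, ∑ i, ∑ j : Fin n, max (v i * (r ^ (j : ℕ) / Z) - l) 0 =
        (∑ i, ∑ j ∈ Finset.range n, max (v i * r ^ j - l * Z) 0) / Z := by
      intro v
      rw [Finset.sum_div]
      refine Finset.sum_congr rfl fun i _ => ?_
      rw [Finset.sum_div, Fin.sum_univ_eq_sum_range
        (fun j => max (v i * (r ^ j / Z) - l) 0)]
      refine Finset.sum_congr rfl fun j _ => ?_
      rw [← max_div_div_right hZ0.le, zero_div]
      congr 1
      field_simp
    rw [e, e]
    exact div_le_div_of_nonneg_right (main _) hZ0.le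

/-- The catalyst criterion, split into one condition at the top of the spectrum of `p ⊗ c` and
`q ⊗ c` and one at the bottom. With `k = a' / b'` every threshold falls under one of the two. -/
lemma exists_isCatalyst_of_hinges_lt {d : ℕ} {p q : Fin d → ℝ} {a b a' b' : ℝ}
    (hp : ∑ i, p i = 1) (hq : ∑ i, q i = 1) (ha' : 0 < a') (hab : a' ≤ a) (hba : a < b')
    (hbb : b ≤ b') (hap : ∀ i, a' ≤ p i) (hpb : ∀ i, p i ≤ b')
    (haq : ∀ i, a ≤ q i) (hqb : ∀ i, q i ≤ b)
    (hupper : ∀ l, a' ≤ l → l ≤ b → ∑ i, upperHinge (q i) l < ∑ i, upperHinge (p i) l)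
    (hlower : ∀ l, a ≤ l → l ≤ b' → ∑ i, lowerHinge (q i) l < ∑ i, lowerHinge (p i) l) :
    ∃ (n : ℕ) (c : Fin n → ℝ), IsCatalyst c p q := by
  have hb' : 0 < b' := by linarith
  have ha : 0 < a := ha'.trans_le hab
  have hp0 : ∀ i, 0 < p i := fun i => ha'.trans_le (hap i)
  have hq0 : ∀ i, 0 < q i := fun i => ha.trans_le (haq i)
  have hk : 0 < a' / b' := by positivity
  refine exists_isCatalyst_of_sum_upperHinge_lt (k := a' / b') hp0 hq0 hp hq hk
    ((div_lt_one hb').2 (by linarith)) ha haq hqb fun l h1 h2 => ?_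
  have hl : 0 < l := (mul_pos hk ha).trans_le h1
  have hle : ∀ x, x ≤ b' → x * (a' / b') ≤ a' := fun x hx => by
    rw [mul_div_assoc', div_le_iff₀ hb', mul_comm]
    exact mul_le_mul_of_nonneg_left hx ha'.le
  rcases le_total a' l with h3 | h3
  -- the lower endpoint `w = k` of the integrals contributes nothing
  · have e : ∀ v : Fin d → ℝ, (∀ i, v i ≤ b') →
        ∑ i, (upperHinge (v i) l - upperHinge (v i * (a' / b')) l) =
          ∑ i, upperHinge (v i) l := fun v hv =>
      Finset.sum_congr rfl fun i _ => by
        rw [upperHinge_of_le hl ((hle _ (hv i)).trans h3), sub_zero]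
    rw [e p hpb, e q fun i => (hqb i).trans hbb]
    exact hupper l h3 h2
  -- the upper endpoint `w = 1` contributes the same for `p` and `q`
  · have e : ∀ v : Fin d → ℝ, (∀ i, a' ≤ v i) → ∑ i, v i = 1 →
        ∑ i, (upperHinge (v i) l - upperHinge (v i * (a' / b')) l) =
          1 - a' / b' + d * (l * Real.log (a' / b')) +
            a' / b' * ∑ i, lowerHinge (v i) (l / (a' / b')) := by
      intro v hv hv1
      have e1 : ∀ i, upperHinge (v i) l - upperHinge (v i * (a' / b')) l =
          (1 - a' / b') * v i + l * Real.log (a' / b') +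
            a' / b' * lowerHinge (v i) (l / (a' / b')) := by
        intro i
        have hvi : 0 < v i := ha'.trans_le (hv i)
        have h4 := upperHinge_add_lowerHinge (z := v i * (a' / b')) hl
        rw [mul_comm (v i), lowerHinge_mul hk] at h4
        rw [upperHinge_of_ge (h3.trans (hv i)), Real.log_div hvi.ne' hl.ne', mul_comm (v i),
          eq_sub_of_add_eq h4, Real.log_div (mul_pos hk hvi).ne' hl.ne',
          Real.log_mul hk.ne' hvi.ne']
        ring
      simp_rw [e1, Finset.sum_add_distrib, ← Finset.mul_sum, hv1]
      simp [mul_left_comm]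
    rw [e p hap hp, e q (fun i => hab.trans (haq i)) hq]
    refine add_lt_add_right (mul_lt_mul_of_pos_left (hlower _ ?_ ?_) hk) _
    · rw [le_div_iff₀ hk]
      linarith
    · rw [div_le_iff₀ hk, mul_div_cancel₀ _ hb'.ne']
      exact h3

/-! ### A catalyst for spectra with four points -/

/-- Positivity of a concave function on an interval follows from positivity at the endpoints. -/
lemma add_mul_sub_mul_log_pos {a b c m l : ℝ} (ha : 0 < a) (hal : a ≤ l) (hlb : l ≤ b)
    (h1 : 0 < c + a * m - a * Real.log a) (h2 : 0 < c + b * m - b * Real.log b) :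
    0 < c + l * m - l * Real.log l := by
  have hconc : ConcaveOn ℝ (Set.Ici 0) fun x : ℝ => (c + x * m) + Real.negMulLog x := by
    refine ConcaveOn.add ⟨convex_Ici 0, fun x _ y _ s t _ _ hst => le_of_eq ?_⟩
      Real.concaveOn_negMulLog
    simp only [smul_eq_mul]
    linear_combination c * hst
  have h := hconc.min_le_of_mem_Icc (Set.mem_Ici.2 ha.le)
    (Set.mem_Ici.2 (ha.le.trans (hal.trans hlb))) ⟨hal, hlb⟩
  simp only [Real.negMulLog] at h
  rcases min_le_iff.1 h with h | h <;> linarith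

lemma mul_log_sub_log_lt {a b : ℝ} (ha : 0 < a) (hab : a < b) :
    a * (Real.log b - Real.log a) < b - a := by
  have hb := ha.trans hab
  have h := Real.log_lt_sub_one_of_pos (div_pos hb ha)
    (by rw [Ne, div_eq_one_iff_eq ha.ne']; exact hab.ne')
  rw [Real.log_div hb.ne' ha.ne'] at h
  have h2 := mul_lt_mul_of_pos_left h ha
  rwa [mul_sub a (b / a), mul_div_cancel₀ _ ha.ne', mul_one] at h2

lemma sub_le_mul_log_sub_log {a b : ℝ} (ha : 0 < a) (hb : 0 < b) :
    a - b ≤ a * (Real.log a - Real.log b) := by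
  rw [← Real.log_div ha.ne' hb.ne']
  exact sub_le_mul_log ha hb

lemma sub_lt_mul_log_sub_log {a b : ℝ} (ha : 0 < a) (hab : a < b) :
    b - a < b * (Real.log b - Real.log a) := by
  have hb := ha.trans hab
  have h := Real.log_lt_sub_one_of_pos (div_pos ha hb)
    (by rw [Ne, div_eq_one_iff_eq hb.ne']; exact hab.ne)
  rw [Real.log_div ha.ne' hb.ne'] at h
  have h2 := mul_lt_mul_of_pos_left h hb
  rw [mul_sub b (a / b), mul_div_cancel₀ _ hb.ne', mul_one] at h2
  linarith

section FourPoints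

variable {p₁ p₂ p₃ q₁ q₂ q₃ q₄ l : ℝ}

/-- The condition at the top of the spectrum. As a function of the threshold `l`, the difference of
the two sides is strictly convex only between `q₃` and `p₂`, where the logarithmic hypothesis
bounds it from below; on the other pieces it is concave or affine, hence controlled by its values at
the endpoints. -/
lemma upperHinge_fourPoints (hp₃ : 0 < p₃) (h34 : p₃ < q₄) (h43 : q₄ ≤ q₃) (h32 : q₃ ≤ p₂)
    (h22 : p₂ ≤ q₂) (h21 : q₂ ≤ q₁) (h11 : q₁ < p₁)
    (hsum : p₁ + 2 * p₂ + p₃ = q₁ + q₂ + q₃ + q₄) (hΔ : p₁ + p₂ < q₁ + q₂)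
    (hlog : Real.log p₁ + 2 * Real.log p₂ + Real.log p₃ <
      Real.log q₁ + Real.log q₂ + Real.log q₃ + Real.log q₄)
    (hK : q₁ + q₂ - p₁ - p₂ <
      q₃ * (Real.log q₁ + Real.log q₂ - Real.log p₁ - Real.log p₂))
    (hl : p₃ ≤ l) (hlq : l ≤ q₁) :
    upperHinge q₁ l + upperHinge q₂ l + upperHinge q₃ l + upperHinge q₄ l <
      upperHinge p₁ l + 2 * upperHinge p₂ l + upperHinge p₃ l := by
  have hq₄ : 0 < q₄ := by linarith
  have hq₃ : 0 < q₃ := by linarith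
  have hp₂ : 0 < p₂ := by linarith
  have hq₂ : 0 < q₂ := by linarith
  have hq₁ : 0 < q₁ := by linarith
  have hp₁ : 0 < p₁ := by linarith
  have hl0 : 0 < l := by linarith
  set K := Real.log q₁ + Real.log q₂ - Real.log p₁ - Real.log p₂ with hKdef
  have hKpos : 0 < K := by
    by_contra hneg
    nlinarith
  have hpq := mul_log_sub_log_lt hq₁ h11
  have hlogpq : 0 < Real.log p₁ - Real.log q₁ := sub_pos.2 (Real.log_lt_log hq₁ h11)
  have htop : ∀ x, x ≤ q₁ → x * (Real.log p₁ - Real.log q₁) < p₁ - q₁ := fun x hx =>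
    (mul_le_mul_of_nonneg_right hx hlogpq.le).trans_lt hpq
  have hmid : ∀ x, q₃ ≤ x → q₁ + q₂ - p₁ - p₂ < x * K := fun x hx =>
    hK.trans_le (mul_le_mul_of_nonneg_right hx hKpos.le)
  -- the affine piece, which extends to all thresholds below `q₃`
  have haff : ∀ x, 0 < x → x ≤ q₃ → 0 < q₄ - p₃ + x * (K + Real.log q₃ - Real.log p₂) := by
    intro x hx hxq
    have h1 := hmid q₃ le_rfl
    have h2 := sub_le_mul_log_sub_log hq₃ hp₂
    rcases le_total 0 (K + Real.log q₃ - Real.log p₂) with h | h <;> nlinarith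
  rw [upperHinge_of_ge (z := p₁) (by linarith), upperHinge_of_ge (z := q₁) hlq,
    upperHinge_of_le (z := p₃) hl0 hl, Real.log_div hp₁.ne' hl0.ne', Real.log_div hq₁.ne' hl0.ne']
  rcases le_total q₂ l with h2 | h2
  · rw [upperHinge_of_le hl0 (h22.trans h2), upperHinge_of_le hl0 h2,
      upperHinge_of_le hl0 (h32.trans (h22.trans h2)),
      upperHinge_of_le hl0 (h43.trans (h32.trans (h22.trans h2)))]
    linarith [htop l hlq]
  rw [upperHinge_of_ge h2, Real.log_div hq₂.ne' hl0.ne']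
  rcases le_total p₂ l with h3 | h3
  · rw [upperHinge_of_le hl0 h3, upperHinge_of_le hl0 (h32.trans h3),
      upperHinge_of_le hl0 (h43.trans (h32.trans h3))]
    have := add_mul_sub_mul_log_pos (c := p₁ - q₁ - q₂) (m := 1 + K + Real.log p₂) hp₂ h3 h2
      (by linarith [hmid p₂ h32]) (by linarith [htop q₂ h21])
    linarith
  rw [upperHinge_of_ge h3, Real.log_div hp₂.ne' hl0.ne']
  rcases le_total q₃ l with h4 | h4
  · rw [upperHinge_of_le hl0 h4, upperHinge_of_le hl0 (h43.trans h4)]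
    linarith [sub_le_mul_log_sub_log hl0 hp₂, hmid l h4]
  rw [upperHinge_of_ge h4, Real.log_div hq₃.ne' hl0.ne']
  rcases le_total q₄ l with h5 | h5
  · rw [upperHinge_of_le hl0 h5]
    linarith [haff l hl0 h4]
  · rw [upperHinge_of_ge h5, Real.log_div hq₄.ne' hl0.ne']
    have := add_mul_sub_mul_log_pos (c := -p₃)
      (m := 1 + K + Real.log q₃ - Real.log p₂ + Real.log q₄) hp₃ hl h5
      (by nlinarith) (by linarith [haff q₄ hq₄ h43])
    linarith

/-- The condition at the bottom of the spectrum, the mirror image of `upperHinge_fourPoints`. -/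
lemma lowerHinge_fourPoints (hp₃ : 0 < p₃) (h34 : p₃ < q₄) (h43 : q₄ ≤ q₃) (h32 : q₃ ≤ p₂)
    (h22 : p₂ ≤ q₂) (h21 : q₂ ≤ q₁) (h11 : q₁ < p₁)
    (hsum : p₁ + 2 * p₂ + p₃ = q₁ + q₂ + q₃ + q₄) (hΔ : p₁ + p₂ < q₁ + q₂)
    (hlog : Real.log p₁ + 2 * Real.log p₂ + Real.log p₃ <
      Real.log q₁ + Real.log q₂ + Real.log q₃ + Real.log q₄)
    (hK : q₂ * (Real.log p₂ + Real.log p₃ - Real.log q₃ - Real.log q₄) <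
      q₁ + q₂ - p₁ - p₂)
    (hl : q₄ ≤ l) (hlp : l ≤ p₁) :
    lowerHinge q₁ l + lowerHinge q₂ l + lowerHinge q₃ l + lowerHinge q₄ l <
      lowerHinge p₁ l + 2 * lowerHinge p₂ l + lowerHinge p₃ l := by
  have hq₄ : 0 < q₄ := by linarith
  have hq₃ : 0 < q₃ := by linarith
  have hp₂ : 0 < p₂ := by linarith
  have hq₂ : 0 < q₂ := by linarith
  have hq₁ : 0 < q₁ := by linarith
  have hp₁ : 0 < p₁ := by linarith
  have hl0 : 0 < l := by linarith
  set K := Real.log p₂ + Real.log p₃ - Real.log q₃ - Real.log q₄ with hKdef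
  have hpq := sub_lt_mul_log_sub_log hp₃ h34
  have hlogpq : 0 < Real.log q₄ - Real.log p₃ := sub_pos.2 (Real.log_lt_log hp₃ h34)
  have hbot : ∀ x, q₄ ≤ x → q₄ - p₃ < x * (Real.log q₄ - Real.log p₃) := fun x hx =>
    hpq.trans_le (mul_le_mul_of_nonneg_right hx hlogpq.le)
  have hmid : ∀ x, 0 < x → x ≤ q₂ → x * K < q₁ + q₂ - p₁ - p₂ := by
    intro x hx hxq
    rcases le_total 0 K with h | h <;> nlinarith
  -- the affine piece, which extends to all thresholds above `q₂`
  have haff : ∀ x, q₂ ≤ x → 0 < q₁ - p₁ + x * (Real.log q₂ - Real.log p₂ - K) := by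
    intro x hx
    have h1 := hmid q₂ hq₂ le_rfl
    have h2 := sub_le_mul_log_sub_log hq₂ hp₂
    have h3 : 0 < Real.log q₂ - Real.log p₂ - K := by
      by_contra hneg
      nlinarith
    nlinarith
  rw [lowerHinge_of_ge (z := p₁) hl0 hlp, lowerHinge_of_le (z := q₄) hl,
    lowerHinge_of_le (z := p₃) (by linarith), Real.log_div hp₃.ne' hl0.ne',
    Real.log_div hq₄.ne' hl0.ne']
  rcases le_total l q₃ with h2 | h2
  · rw [lowerHinge_of_ge hl0 (h2.trans h32), lowerHinge_of_ge hl0 h2,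
      lowerHinge_of_ge hl0 (h2.trans (h32.trans h22)),
      lowerHinge_of_ge hl0 (h2.trans (h32.trans (h22.trans h21)))]
    linarith [hbot l hl]
  rw [lowerHinge_of_le h2, Real.log_div hq₃.ne' hl0.ne']
  rcases le_total l p₂ with h3 | h3
  · rw [lowerHinge_of_ge hl0 h3, lowerHinge_of_ge hl0 (h3.trans h22),
      lowerHinge_of_ge hl0 (h3.trans (h22.trans h21))]
    have := add_mul_sub_mul_log_pos (c := p₃ - q₃ - q₄) (m := 1 + Real.log p₂ - K) hq₃ h2 h3
      (by linarith [hbot q₃ h43]) (by linarith [hmid p₂ hp₂ h22])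
    linarith
  rw [lowerHinge_of_le h3, Real.log_div hp₂.ne' hl0.ne']
  rcases le_total l q₂ with h4 | h4
  · rw [lowerHinge_of_ge hl0 h4, lowerHinge_of_ge hl0 (h4.trans h21)]
    linarith [sub_le_mul_log_sub_log hl0 hp₂, hmid l hl0 h4]
  rw [lowerHinge_of_le h4, Real.log_div hq₂.ne' hl0.ne']
  rcases le_total l q₁ with h5 | h5
  · rw [lowerHinge_of_ge hl0 h5]
    linarith [haff l h4]
  · rw [lowerHinge_of_le h5, Real.log_div hq₁.ne' hl0.ne']
    have := add_mul_sub_mul_log_pos (c := -p₁)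
      (m := 1 + Real.log q₁ + Real.log q₂ - Real.log p₂ - K) hq₁ h5 hlp
      (by linarith [haff q₁ h21]) (by nlinarith)
    linarith

end FourPoints

/-! ### Two-bit distributions along the critical curve -/

/-- The probability distribution of a bit with bias `x`. -/
noncomputable def bit (x : ℝ) : Fin 2 → ℝ := ![(1 + x) / 2, (1 - x) / 2]

lemma sum_tensor_bit (x y : ℝ) (g : ℝ → ℝ) :
    ∑ k, g (tensor (bit x) (bit y) k) = g ((1 + x) / 2 * ((1 + y) / 2)) +
      g ((1 + x) / 2 * ((1 - y) / 2)) + g ((1 - x) / 2 * ((1 + y) / 2)) +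
      g ((1 - x) / 2 * ((1 - y) / 2)) := by
  rw [sum_tensor]
  simp only [Fin.sum_univ_two, bit, Matrix.cons_val_zero, Matrix.cons_val_one]
  ring

lemma sum_tensor_bit_eq_one (x y : ℝ) : ∑ k, tensor (bit x) (bit y) k = 1 := by
  rw [sum_tensor_bit x y fun z => z]
  ring

lemma bit_mem_Icc {x : ℝ} (hx : 0 ≤ x) (i : Fin 2) :
    bit x i ∈ Set.Icc ((1 - x) / 2) ((1 + x) / 2) := by
  fin_cases i <;> constructor <;> simp [bit] <;> linarith

lemma tensor_bit_mem_Icc {x y : ℝ} (hx : 0 ≤ x) (hx' : x ≤ 1) (hy : 0 ≤ y) (hy' : y ≤ 1)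
    (k : Fin (2 * 2)) : tensor (bit x) (bit y) k ∈
      Set.Icc ((1 - x) / 2 * ((1 - y) / 2)) ((1 + x) / 2 * ((1 + y) / 2)) := by
  have h1 := bit_mem_Icc hx (finProdFinEquiv.symm k).1
  have h2 := bit_mem_Icc hy (finProdFinEquiv.symm k).2
  exact ⟨mul_le_mul h1.1 h2.1 (by linarith) (by linarith [h1.1]),
    mul_le_mul h1.2 h2.2 (by linarith [h2.1]) (by linarith)⟩

/-- The bound `2 * z / (z + 2) ≤ log (1 + z)` at `1 + z = (m + t) / (m - t)`. -/
lemma two_mul_div_le_log_sub_log {m t : ℝ} (ht : 0 ≤ t) (htm : t < m) :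
    2 * (t / m) ≤ Real.log (m + t) - Real.log (m - t) := by
  have hm : 0 < m := by linarith
  have h1 : 0 < m - t := by linarith
  have h := Real.le_log_one_add_of_nonneg (x := 2 * t / (m - t)) (by positivity)
  rw [← Real.log_div (by linarith) h1.ne']
  convert h using 1
  · field_simp
    ring
  · congr 1
    field_simp
    ring

/-- The bound `log z ≤ (z - z⁻¹) / 2` at `z = (m + t) / (m - t)`. -/
lemma log_sub_log_le {m t : ℝ} (ht : 0 ≤ t) (htm : t < m) :
    Real.log (m + t) - Real.log (m - t) ≤ 2 * (t * m) / (m ^ 2 - t ^ 2) := by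
  have hm : 0 < m := by linarith
  have h1 : 0 < m - t := by linarith
  have h2 : 0 < m + t := by linarith
  have h := Real.self_le_sinh_iff.2 (Real.log_nonneg (x := (m + t) / (m - t))
    ((one_le_div h1).2 (by linarith)))
  rw [Real.sinh_log (by positivity)] at h
  rw [← Real.log_div h2.ne' h1.ne']
  refine h.trans (le_of_eq ?_)
  rw [show m ^ 2 - t ^ 2 = (m - t) * (m + t) by ring]
  field_simp
  ring

lemma le_log_sub_log_of_mul_le {a b c : ℝ} (ha : 0 < a) (hb : 0 < b) (h : c * a ≤ a - b) :
    c ≤ Real.log a - Real.log b :=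
  le_of_mul_le_mul_left (by linarith [sub_le_mul_log_sub_log ha hb]) ha

/-- The inequality at the top of the spectrum: its two sides agree to first order in `t`. -/
lemma lt_mul_of_le_log {m t K : ℝ} (hm : 0.7866 ≤ m) (hm' : m ≤ 0.8235) (ht : 0 < t)
    (ht' : t ≤ 0.15) (hK : t / m - 1.2 * t ^ 2 ≤ K) :
    (t - 3 * t ^ 2) / 4 < (m - t) / 4 * K := by
  have hmt : 0 < m - t := by linarith
  refine lt_of_lt_of_le ?_ (mul_le_mul_of_nonneg_left hK (by linarith))
  have hinv : t * (t / m) ≤ 1.28 * t ^ 2 := by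
    rw [mul_div_assoc', div_le_iff₀ (by linarith)]
    nlinarith
  have e : (m - t) / 4 * (t / m - 1.2 * t ^ 2) =
      (t - t * (t / m) - 1.2 * (m - t) * t ^ 2) / 4 := by
    have : m * (t / m) = t := mul_div_cancel₀ _ (by linarith)
    linear_combination this / 4
  have h : (m - t) * t ^ 2 ≤ 0.8235 * t ^ 2 :=
    mul_le_mul_of_nonneg_right (by linarith) (by positivity)
  rw [e]
  nlinarith [sq_pos_of_pos ht]

/-- The inequality at the bottom of the spectrum: its two sides agree to first order in `t`. -/
lemma mul_lt_of_log_le {m t K : ℝ} (hm : 0.7866 ≤ m) (ht : 0 < t) (ht' : t ≤ 0.15)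
    (hK : K ≤ t * m / (m ^ 2 - t ^ 2) - (5.775 - 3.2 * t) * t ^ 2) :
    (m + t) / 4 * K < (t - 3 * t ^ 2) / 4 := by
  have hmt : 0 < m - t := by linarith
  have hmt' : 0 < m + t := by linarith
  refine lt_of_le_of_lt (mul_le_mul_of_nonneg_left hK (by linarith)) ?_
  have e : (m + t) / 4 * (t * m / (m ^ 2 - t ^ 2) - (5.775 - 3.2 * t) * t ^ 2) =
      (t + t ^ 2 * (1 / (m - t) - (m + t) * (5.775 - 3.2 * t))) / 4 := by
    rw [show m ^ 2 - t ^ 2 = (m - t) * (m + t) by ring]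
    field_simp
    ring
  have h5 : 1 / (m - t) ≤ 1.2714 + 2.2 * t := by
    rw [div_le_iff₀ hmt]
    nlinarith
  have h6 : 4.5 + 2 * t ≤ (m + t) * (5.775 - 3.2 * t) := by nlinarith
  rw [e]
  have h7 := mul_lt_mul_of_pos_left (show 1 / (m - t) - (m + t) * (5.775 - 3.2 * t) < -3 by
    linarith) (sq_pos_of_pos ht)
  linarith

/-- The order of the entries of the joint distributions with biases `(k / 2, k / 2)` and `(x, y)`,
and second-order bounds on the logarithms of their ratios. The biases `x` and `y` have mean
`(k - 3 * t ^ 2) / 2` and difference `t`, and `m = 1 - x * y`. -/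
lemma log_ratio_bounds {k t m p₁ p₂ p₃ q₁ q₂ q₃ q₄ : ℝ} (hk : 0.9238 < k) (hk' : k < 0.9239)
    (ht : 0 < t) (ht' : t ≤ 0.15) (hm : m = 1 - ((k - 3 * t ^ 2) ^ 2 - t ^ 2) / 4)
    (hp₁ : p₁ = (1 + k + k ^ 2 / 4) / 4) (hp₂ : p₂ = (1 - k ^ 2 / 4) / 4)
    (hp₃ : p₃ = (1 - k + k ^ 2 / 4) / 4) (hq₁ : q₁ = (2 + (k - 3 * t ^ 2) - m) / 4)
    (hq₂ : q₂ = (m + t) / 4) (hq₃ : q₃ = (m - t) / 4)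
    (hq₄ : q₄ = (2 - (k - 3 * t ^ 2) - m) / 4) :
    (0.7866 ≤ m ∧ m ≤ 0.8235) ∧
    (0 < p₃ ∧ p₃ < q₄ ∧ q₄ ≤ q₃ ∧ q₃ ≤ p₂ ∧ p₂ ≤ q₂ ∧ q₂ ≤ q₁ ∧ q₁ < p₁) ∧
    -2.32 * t ^ 2 ≤ Real.log q₁ - Real.log p₁ ∧
    2.25 * t ^ 2 ≤ Real.log q₂ + Real.log q₃ - 2 * Real.log p₂ ∧
    (4.65 - 3.2 * t) * t ^ 2 ≤ Real.log q₄ - Real.log p₃ := by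
  have ht2 : 0 < t ^ 2 := by positivity
  have ht2' : t ^ 2 ≤ 0.0225 := by nlinarith
  have hk2 : 0.8534 < k ^ 2 := by nlinarith
  have hk2' : k ^ 2 < 0.8536 := by nlinarith
  -- `s * t ^ 2` is the increase of `m` over its value at `t = 0`
  obtain ⟨s, hs⟩ : ∃ s, s = (6 * k + 1 - 9 * t ^ 2) / 4 := ⟨_, rfl⟩
  have hms : m = 1 - k ^ 2 / 4 + s * t ^ 2 := by rw [hm, hs]; ring
  clear hm
  have hs1 : 1.58 ≤ s := by linarith
  have hs2 : s ≤ 1.636 := by linarith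
  have hst0 : 1.58 * t ^ 2 ≤ s * t ^ 2 := mul_le_mul_of_nonneg_right hs1 ht2.le
  have hst1 : s * t ^ 2 ≤ 1.636 * t ^ 2 := mul_le_mul_of_nonneg_right hs2 ht2.le
  have hst : s * t ^ 2 ≤ t := by nlinarith
  have hm1 : 0.7866 ≤ m := by linarith
  have hm2 : m ≤ 0.8235 := by linarith
  have e₁ : p₁ - q₁ = (3 + s) * t ^ 2 / 4 := by rw [hp₁, hq₁, hms]; ring
  have e₃ : q₄ - p₃ = (3 - s) * t ^ 2 / 4 := by rw [hp₃, hq₄, hms]; ring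
  have hp₁0 : 0 < p₁ := by linarith
  have hp₂0 : 0 < p₂ := by linarith
  have hp₃0 : 0 < p₃ := by linarith
  have hq₂0 : 0 < q₂ := by linarith
  have hq₃0 : 0 < q₃ := by linarith
  have h34 : p₃ < q₄ := by linarith
  have hq₄0 : 0 < q₄ := hp₃0.trans h34
  have hq₁1 : 0.5 ≤ q₁ := by linarith
  refine ⟨⟨hm1, hm2⟩, ⟨hp₃0, h34, by linarith, by linarith, by linarith, by linarith,
    by linarith⟩, ?_, ?_, ?_⟩
  · refine le_log_sub_log_of_mul_le (by linarith) hp₁0 ?_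
    nlinarith only [e₁, hst1, mul_le_mul_of_nonneg_right hq₁1 ht2.le]
  · -- the two middle entries enter through their product
    have h := le_log_sub_log_of_mul_le (a := q₂ * q₃) (b := p₂ * p₂) (c := 2.25 * t ^ 2)
      (by positivity) (by positivity) ?_
    · rw [Real.log_mul hq₂0.ne' hq₃0.ne', Real.log_mul hp₂0.ne' hp₂0.ne'] at h
      linarith
    obtain ⟨m₀, hm₀⟩ : ∃ m₀, m₀ = 1 - k ^ 2 / 4 := ⟨_, rfl⟩
    have hm₀1 : 0.7866 ≤ m₀ := by linarith
    have hm₀2 : m₀ ≤ 0.78665 := by linarith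
    have hmm : m ≤ 0.78665 + 1.636 * t ^ 2 := by linarith
    have h1 : m ^ 2 - t ^ 2 ≤ 0.6557 := by nlinarith only [hmm, hm1, ht2', ht2]
    have h2 : 1.4754 ≤ 2 * m₀ * s + s ^ 2 * t ^ 2 - 1 := by nlinarith only [hm₀1, hs1, ht2]
    have e : q₂ * q₃ - p₂ * p₂ = t ^ 2 * (2 * m₀ * s + s ^ 2 * t ^ 2 - 1) / 16 := by
      rw [hq₂, hq₃, hp₂, hms, ← hm₀]
      ring
    have e' : q₂ * q₃ = (m ^ 2 - t ^ 2) / 16 := by rw [hq₂, hq₃]; ring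
    rw [e, e']
    nlinarith only [mul_le_mul_of_nonneg_left h1 ht2.le, mul_le_mul_of_nonneg_left h2 ht2.le]
  · refine le_log_sub_log_of_mul_le hq₄0 hp₃0 ?_
    have h1 : 4 * q₄ ≤ 0.2896 + 1.42 * t ^ 2 := by nlinarith only [e₃, hst0, hp₃, hk, hk2']
    have h2 : (4.65 - 3.2 * t) * (4 * q₄) ≤ 3 - s := by
      refine (mul_le_mul_of_nonneg_left h1 (by linarith)).trans ?_
      nlinarith only [hs, hk', ht, ht']
    rw [e₃]
    nlinarith only [mul_le_mul_of_nonneg_right h2 ht2.le]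

/-- On the curve `x + y = k - 3 * (x - y) ^ 2` there is a catalyst for the conversion of two bits
with bias `k / 2` into bits with biases `x` and `y`. -/
lemma exists_isCatalyst_bit {k t : ℝ} (hk : 0.9238 < k) (hk' : k < 0.9239) (ht : 0 < t)
    (ht' : t ≤ 0.15) :
    ∃ (n : ℕ) (c : Fin n → ℝ), IsCatalyst c (tensor (bit (k / 2)) (bit (k / 2)))
      (tensor (bit ((k + t - 3 * t ^ 2) / 2)) (bit ((k - t - 3 * t ^ 2) / 2))) := by
  obtain ⟨m, hm⟩ : ∃ m, m = 1 - ((k - 3 * t ^ 2) ^ 2 - t ^ 2) / 4 := ⟨_, rfl⟩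
  obtain ⟨p₁, hp₁⟩ : ∃ p₁, p₁ = (1 + k + k ^ 2 / 4) / 4 := ⟨_, rfl⟩
  obtain ⟨p₂, hp₂⟩ : ∃ p₂, p₂ = (1 - k ^ 2 / 4) / 4 := ⟨_, rfl⟩
  obtain ⟨p₃, hp₃⟩ : ∃ p₃, p₃ = (1 - k + k ^ 2 / 4) / 4 := ⟨_, rfl⟩
  obtain ⟨q₁, hq₁⟩ : ∃ q₁, q₁ = (2 + (k - 3 * t ^ 2) - m) / 4 := ⟨_, rfl⟩
  obtain ⟨q₂, hq₂⟩ : ∃ q₂, q₂ = (m + t) / 4 := ⟨_, rfl⟩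
  obtain ⟨q₃, hq₃⟩ : ∃ q₃, q₃ = (m - t) / 4 := ⟨_, rfl⟩
  obtain ⟨q₄, hq₄⟩ : ∃ q₄, q₄ = (2 - (k - 3 * t ^ 2) - m) / 4 := ⟨_, rfl⟩
  obtain ⟨⟨hm1, hm2⟩, ⟨hp₃0, h34, h43, h32, h22, h21, h11⟩, hl₁, hl₂, hl₃⟩ :=
    log_ratio_bounds hk hk' ht ht' hm hp₁ hp₂ hp₃ hq₁ hq₂ hq₃ hq₄
  have ht2 : 0 < t ^ 2 := by positivity
  have hsum : p₁ + 2 * p₂ + p₃ = q₁ + q₂ + q₃ + q₄ := by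
    rw [hp₁, hp₂, hp₃, hq₁, hq₂, hq₃, hq₄]; ring
  have hdiff : q₁ + q₂ - p₁ - p₂ = (t - 3 * t ^ 2) / 4 := by rw [hq₁, hq₂, hp₁, hp₂]; ring
  have hΔ : p₁ + p₂ < q₁ + q₂ := by nlinarith only [hdiff, ht, ht']
  have hlog : Real.log p₁ + 2 * Real.log p₂ + Real.log p₃ <
      Real.log q₁ + Real.log q₂ + Real.log q₃ + Real.log q₄ := by
    have : 4 * t ^ 2 ≤ (4.65 - 3.2 * t) * t ^ 2 :=
      mul_le_mul_of_nonneg_right (by linarith) ht2.le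
    linarith
  have hq23 : Real.log q₂ - Real.log q₃ = Real.log (m + t) - Real.log (m - t) := by
    rw [hq₂, hq₃, Real.log_div (by linarith) (by norm_num),
      Real.log_div (by linarith) (by norm_num)]
    ring
  -- the logarithms combine to `(log q₂ - log q₃) / 2`, which carries the first order in `t`, and
  -- to differences bounded by `log_ratio_bounds`
  have hlow := two_mul_div_le_log_sub_log ht.le (show t < m by linarith)
  have hupp := log_sub_log_le ht.le (show t < m by linarith)
  rw [← hq23] at hlow hupp
  have hK : q₁ + q₂ - p₁ - p₂ <
      q₃ * (Real.log q₁ + Real.log q₂ - Real.log p₁ - Real.log p₂) := by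
    rw [hdiff]
    have h := lt_mul_of_le_log hm1 hm2 ht ht'
      (K := Real.log q₁ + Real.log q₂ - Real.log p₁ - Real.log p₂) (by linarith)
    rwa [← hq₃] at h
  have hK' : q₂ * (Real.log p₂ + Real.log p₃ - Real.log q₃ - Real.log q₄) <
      q₁ + q₂ - p₁ - p₂ := by
    rw [hdiff]
    have e : 2 * (t * m) / (m ^ 2 - t ^ 2) = 2 * (t * m / (m ^ 2 - t ^ 2)) := by ring
    have h := mul_lt_of_log_le hm1 ht ht'
      (K := Real.log p₂ + Real.log p₃ - Real.log q₃ - Real.log q₄) (by linarith)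
    rwa [← hq₂] at h
  have ep : ∀ g : ℝ → ℝ, ∑ i, g (tensor (bit (k / 2)) (bit (k / 2)) i) =
      g p₁ + 2 * g p₂ + g p₃ := by
    intro g
    rw [sum_tensor_bit, show (1 + k / 2) / 2 * ((1 + k / 2) / 2) = p₁ by rw [hp₁]; ring,
      show (1 + k / 2) / 2 * ((1 - k / 2) / 2) = p₂ by rw [hp₂]; ring,
      show (1 - k / 2) / 2 * ((1 + k / 2) / 2) = p₂ by rw [hp₂]; ring,
      show (1 - k / 2) / 2 * ((1 - k / 2) / 2) = p₃ by rw [hp₃]; ring]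
    ring
  have eq : ∀ g : ℝ → ℝ, ∑ i, g (tensor (bit ((k + t - 3 * t ^ 2) / 2))
      (bit ((k - t - 3 * t ^ 2) / 2)) i) = g q₁ + g q₂ + g q₃ + g q₄ := by
    intro g
    rw [sum_tensor_bit,
      show (1 + (k + t - 3 * t ^ 2) / 2) / 2 * ((1 + (k - t - 3 * t ^ 2) / 2) / 2) = q₁ by
        rw [hq₁, hm]; ring,
      show (1 + (k + t - 3 * t ^ 2) / 2) / 2 * ((1 - (k - t - 3 * t ^ 2) / 2) / 2) = q₂ by
        rw [hq₂, hm]; ring,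
      show (1 - (k + t - 3 * t ^ 2) / 2) / 2 * ((1 + (k - t - 3 * t ^ 2) / 2) / 2) = q₃ by
        rw [hq₃, hm]; ring,
      show (1 - (k + t - 3 * t ^ 2) / 2) / 2 * ((1 - (k - t - 3 * t ^ 2) / 2) / 2) = q₄ by
        rw [hq₄, hm]; ring]
  have hx0 : 0 ≤ (k + t - 3 * t ^ 2) / 2 := by nlinarith only [ht, ht', hk]
  have hx1 : (k + t - 3 * t ^ 2) / 2 ≤ 1 := by nlinarith only [ht', hk', ht2]
  have hy0 : 0 ≤ (k - t - 3 * t ^ 2) / 2 := by nlinarith only [ht, ht', hk]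
  have hy1 : (k - t - 3 * t ^ 2) / 2 ≤ 1 := by nlinarith only [ht, hk', ht2]
  refine exists_isCatalyst_of_hinges_lt (a := q₄) (b := q₁) (a' := p₃) (b' := p₁)
    (sum_tensor_bit_eq_one _ _) (sum_tensor_bit_eq_one _ _) hp₃0 h34.le (by linarith) h11.le
    (fun i => ?_) (fun i => ?_) (fun i => ?_) (fun i => ?_) (fun l hl hl' => ?_)
    fun l hl hl' => ?_
  · refine le_trans (le_of_eq ?_) (tensor_bit_mem_Icc (by linarith) (by linarith) (by linarith)
      (by linarith) i).1
    rw [hp₃]; ring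
  · refine (tensor_bit_mem_Icc (by linarith) (by linarith) (by linarith)
      (by linarith) i).2.trans (le_of_eq ?_)
    rw [hp₁]; ring
  · refine le_trans (le_of_eq ?_) (tensor_bit_mem_Icc hx0 hx1 hy0 hy1 i).1
    rw [hq₄, hm]; ring
  · refine (tensor_bit_mem_Icc hx0 hx1 hy0 hy1 i).2.trans (le_of_eq ?_)
    rw [hq₁, hm]; ring
  · rw [ep fun z => upperHinge z l, eq fun z => upperHinge z l]
    exact upperHinge_fourPoints hp₃0 h34 h43 h32 h22 h21 h11 hsum hΔ hlog hK hl hl'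
  · rw [ep fun z => lowerHinge z l, eq fun z => lowerHinge z l]
    exact lowerHinge_fourPoints hp₃0 h34 h43 h32 h22 h21 h11 hsum hΔ hlog hK' hl hl'

/-! ### Two bits with biases in an ellipse -/

lemma bit_neg (x : ℝ) : bit (-x) = bit x ∘ Equiv.swap 0 1 := by
  ext i
  fin_cases i <;> simp [bit, sub_eq_add_neg]

lemma permEquiv_bit {x y : ℝ} (h : |x| = |y|) : PermEquiv (bit x) (bit y) := by
  rcases abs_eq_abs.1 h with rfl | rfl
  · exact ⟨1, rfl⟩
  · refine ⟨Equiv.swap 0 1, ?_⟩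
    rw [← bit_neg, neg_neg]

lemma PermEquiv.tensor {m n : ℕ} {p p' : Fin m → ℝ} {q q' : Fin n → ℝ} (hp : PermEquiv p p')
    (hq : PermEquiv q q') : PermEquiv (tensor p q) (MUS.tensor p' q') := by
  obtain ⟨π, rfl⟩ := hp
  obtain ⟨τ, rfl⟩ := hq
  refine ⟨finProdFinEquiv.symm.trans ((Equiv.prodCongr π τ).trans finProdFinEquiv), ?_⟩
  ext k
  simp [MUS.tensor]

lemma PermEquiv.sum_eq {d : ℕ} {p q : Fin d → ℝ} (h : PermEquiv p q) (g : ℝ → ℝ) :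
    ∑ i, g (p i) = ∑ i, g (q i) := by
  obtain ⟨π, rfl⟩ := h
  exact (Equiv.sum_comp π fun i => g (p i)).symm

lemma bit_mem_stdSimplex {x : ℝ} (h : |x| ≤ 1) : bit x ∈ stdSimplex ℝ (Fin 2) := by
  have h' := abs_le.1 h
  refine ⟨fun i => ?_, ?_⟩
  · fin_cases i <;> simp [bit] <;> linarith
  · rw [Fin.sum_univ_two]
    simp [bit]
    ring

lemma bit_pos {x : ℝ} (h : |x| < 1) (i : Fin 2) : 0 < bit x i := by
  have h' := abs_lt.1 h
  fin_cases i <;> simp [bit] <;> linarith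

/-- The hinge functionals of a bit increase with its bias. -/
lemma hinge_bit_le {x y a l : ℝ} (ha : 0 ≤ a) (h : |x| ≤ y) :
    max ((1 + x) / 2 * a - l) 0 + max ((1 - x) / 2 * a - l) 0 ≤
      max ((1 + y) / 2 * a - l) 0 + max ((1 - y) / 2 * a - l) 0 := by
  obtain ⟨h1, h2⟩ := abs_le.1 h
  have h3 := mul_le_mul_of_nonneg_right h1 ha
  have h4 := mul_le_mul_of_nonneg_right h2 ha
  have m1 := le_max_left ((1 + y) / 2 * a - l) 0
  have m2 := le_max_right ((1 + y) / 2 * a - l) 0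
  have m3 := le_max_left ((1 - y) / 2 * a - l) 0
  have m4 := le_max_right ((1 - y) / 2 * a - l) 0
  rcases max_cases ((1 + x) / 2 * a - l) 0 with ⟨e1, -⟩ | ⟨e1, -⟩ <;>
  rcases max_cases ((1 - x) / 2 * a - l) 0 with ⟨e2, -⟩ | ⟨e2, -⟩ <;>
  rw [e1, e2] <;> linarith

/-- Whether `c` is a catalyst depends only on the hinge functionals of the two distributions. -/
lemma isCatalyst_of_sum_le {d d' n : ℕ} {c : Fin n → ℝ} {p q : Fin d → ℝ} {p' q' : Fin d' → ℝ}
    (h : IsCatalyst c p q)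
    (hp : ∀ a l : ℝ, 0 ≤ a → ∑ i, max (p i * a - l) 0 ≤ ∑ i, max (p' i * a - l) 0)
    (hq : ∀ a l : ℝ, 0 ≤ a → ∑ i, max (q' i * a - l) 0 ≤ ∑ i, max (q i * a - l) 0) :
    IsCatalyst c p' q' := by
  refine ⟨h.1, h.2.1, fun l => ?_⟩
  have h3 := h.2.2 l
  rw [Finset.sum_comm, Finset.sum_comm (f := fun i j => max (p i * c j - l) 0)] at h3
  rw [Finset.sum_comm, Finset.sum_comm (f := fun i j => max (p' i * c j - l) 0)]
  exact (Finset.sum_le_sum fun j _ => hq (c j) l (h.1.1 j)).trans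
    (h3.trans (Finset.sum_le_sum fun j _ => hp (c j) l (h.1.1 j)))

lemma sum_hinge_tensor_bit_le {x y x' y' a l : ℝ} (ha : 0 ≤ a) (hx : |x| ≤ x') (hy : |y| ≤ y')
    (hx' : x' ≤ 1) (hy' : y' ≤ 1) :
    ∑ i, max (tensor (bit x) (bit y) i * a - l) 0 ≤
      ∑ i, max (tensor (bit x') (bit y') i * a - l) 0 := by
  rw [sum_tensor_bit x y fun z => max (z * a - l) 0,
    sum_tensor_bit x' y' fun z => max (z * a - l) 0]
  have hx0 := (abs_nonneg x).trans hx
  have hy1 := abs_le.1 hy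
  have h1 := hinge_bit_le (x := x) (y := x') (a := (1 + y) / 2 * a) (l := l)
    (mul_nonneg (by linarith) ha) hx
  have h2 := hinge_bit_le (x := x) (y := x') (a := (1 - y) / 2 * a) (l := l)
    (mul_nonneg (by linarith) ha) hx
  have h3 := hinge_bit_le (x := y) (y := y') (a := (1 + x') / 2 * a) (l := l)
    (mul_nonneg (by linarith) ha) hy
  have h4 := hinge_bit_le (x := y) (y := y') (a := (1 - x') / 2 * a) (l := l)
    (mul_nonneg (by linarith) ha) hy
  simp only [← mul_assoc] at h1 h2 h3 h4
  simp only [mul_comm _ ((1 + x') / 2), mul_comm _ ((1 - x') / 2)] at h3 h4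
  linarith

/-- Every point of the ellipse is dominated by a point of the curve `x + y = k - 3 * (x - y) ^ 2`.
The constant `5.828` is slightly below `3 + 2 * √2`, the squared ratio of the axes of the ellipse,
and `3` is slightly below half of that, divided by `k`, so that the curve stays outside the ellipse
near the vertex. -/
lemma exists_curve_ge {k x y : ℝ} (hk : 0.9238 < k) (hk' : k < 0.9239) (hyx : y ≤ x)
    (hx : x ≤ 1 / 2) (h : (x + y) ^ 2 + 5.828 * (x - y) ^ 2 ≤ k ^ 2) :
    ∃ t, 0 ≤ t ∧ t ≤ 0.15 ∧ x ≤ (k + t - 3 * t ^ 2) / 2 ∧ y ≤ (k - t - 3 * t ^ 2) / 2 := by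
  rcases le_total (x - y) 0.15 with ht | ht
  · have h1 : x + y ≤ k - 3 * (x - y) ^ 2 := by
      refine abs_le_of_sq_le_sq' ?_ ?_ |>.2
      · nlinarith [sq_nonneg (x - y), sq_nonneg ((x - y) ^ 2)]
      · nlinarith
    exact ⟨x - y, by linarith, ht, by linarith, by linarith⟩
  · -- far from the vertex the endpoint `t = 0.15` of the curve dominates
    have h1 : x + y ≤ 0.85 := by nlinarith
    exact ⟨0.15, by norm_num, le_rfl, by norm_num; linarith, by norm_num; linarith⟩

lemma exists_isCatalyst_of_curve {k t : ℝ} (hk : 0.9238 < k) (hk' : k < 0.9239) (ht : 0 ≤ t)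
    (ht' : t ≤ 0.15) :
    ∃ (n : ℕ) (c : Fin n → ℝ), IsCatalyst c (tensor (bit (k / 2)) (bit (k / 2)))
      (tensor (bit ((k + t - 3 * t ^ 2) / 2)) (bit ((k - t - 3 * t ^ 2) / 2))) := by
  rcases ht.eq_or_lt with rfl | ht
  -- at the vertex itself the trivial catalyst does
  · refine ⟨1, fun _ => 1, ⟨fun _ => zero_le_one, by simp⟩, fun _ => one_pos, fun l => ?_⟩
    simp
  · exact exists_isCatalyst_bit hk hk' ht ht'

/-- Two bits whose biases lie in the ellipse can be obtained catalytically from two bits of bias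
`k / 2`, where `(k / 2, k / 2)` is a vertex of the ellipse. -/
lemma exists_isCatalyst_of_mem_ellipse {k x₀ y₀ x y : ℝ} (hk : 0.9238 < k) (hk' : k < 0.9239)
    (hx₀ : |x₀| = k / 2) (hy₀ : |y₀| = k / 2) (hx : |x| ≤ 1 / 2) (hy : |y| ≤ 1 / 2)
    (h : (|x| + |y|) ^ 2 + 5.828 * (|x| - |y|) ^ 2 ≤ k ^ 2) :
    ∃ (n : ℕ) (c : Fin n → ℝ), IsCatalyst c (tensor (bit x₀) (bit y₀))
      (tensor (bit x) (bit y)) := by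
  have hperm : PermEquiv (tensor (bit (k / 2)) (bit (k / 2))) (tensor (bit x₀) (bit y₀)) :=
    (permEquiv_bit (by rw [hx₀, abs_of_pos (by linarith)])).tensor
      (permEquiv_bit (by rw [hy₀, abs_of_pos (by linarith)]))
  have key : ∀ x y : ℝ, |y| ≤ |x| → |x| ≤ 1 / 2 →
      (|x| + |y|) ^ 2 + 5.828 * (|x| - |y|) ^ 2 ≤ k ^ 2 →
      ∃ (n : ℕ) (c : Fin n → ℝ), IsCatalyst c (tensor (bit x₀) (bit y₀))
        (tensor (bit x) (bit y)) := by
    intro x y hyx hx h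
    obtain ⟨t, ht0, ht1, hxt, hyt⟩ := exists_curve_ge hk hk' hyx hx h
    obtain ⟨n, c, hc⟩ := exists_isCatalyst_of_curve hk hk' ht0 ht1
    exact ⟨n, c, isCatalyst_of_sum_le hc (fun a l _ => (hperm.sum_eq fun z => max (z * a - l) 0).le)
      fun a l ha => sum_hinge_tensor_bit_le ha hxt hyt (by nlinarith) (by nlinarith)⟩
  rcases le_total |y| |x| with hyx | hxy
  · exact key x y hyx hx h
  · -- exchanging the two bits only permutes the entries
    obtain ⟨n, c, hc⟩ := key y x hxy hy (by linarith)
    refine ⟨n, c, isCatalyst_of_sum_le hc (fun _ _ _ => le_rfl) fun a l _ => le_of_eq ?_⟩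
    rw [sum_tensor_bit x y fun z => max (z * a - l) 0,
      sum_tensor_bit y x fun z => max (z * a - l) 0]
    simp only [mul_comm ((1 + y) / 2), mul_comm ((1 - y) / 2)]
    ring

/-- Among the points of the ellipse the vertex maximises the largest entry and minimises the
smallest one. -/
lemma extreme_entries_of_mem_ellipse {k x y : ℝ} (hk : 0.9238 < k) (hk' : k < 0.9239)
    (hy0 : 0 ≤ y) (hyx : y ≤ x) (hx : x ≤ 1 / 2)
    (h : (x + y) ^ 2 + 5.828 * (x - y) ^ 2 ≤ k ^ 2) (hne : ¬ (x = k / 2 ∧ y = k / 2)) :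
    (1 + x) * (1 + y) < (1 + k / 2) ^ 2 ∧ (1 - k / 2) ^ 2 < (1 - x) * (1 - y) := by
  obtain ⟨t, ht0, ht1, hxt, hyt⟩ := exists_curve_ge hk hk' hyx hx h
  rcases ht0.eq_or_lt with rfl | ht0
  · have hxk : x ≤ k / 2 := by linarith
    have hyk : y ≤ k / 2 := by linarith
    have hlt : y < k / 2 := lt_of_le_of_ne hyk fun hy => hne ⟨by linarith, hy⟩
    constructor <;> nlinarith
  · have ht2 : 0 < t ^ 2 := by positivity
    constructor
    · have : (1 + x) * (1 + y) ≤ (1 + (k + t - 3 * t ^ 2) / 2) * (1 + (k - t - 3 * t ^ 2) / 2) :=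
        mul_le_mul (by linarith) (by linarith) (by linarith) (by linarith)
      nlinarith
    · have : (1 - (k + t - 3 * t ^ 2) / 2) * (1 - (k - t - 3 * t ^ 2) / 2) ≤ (1 - x) * (1 - y) :=
        mul_le_mul (by linarith) (by linarith) (by nlinarith) (by linarith)
      nlinarith

lemma permEquiv_tensor_bit_abs (x y : ℝ) :
    PermEquiv (tensor (bit |x|) (bit |y|)) (tensor (bit x) (bit y)) :=
  (permEquiv_bit (abs_abs x)).tensor (permEquiv_bit (abs_abs y))

lemma tensor_bit_mem_Icc_abs {x y : ℝ} (hx : |x| ≤ 1) (hy : |y| ≤ 1) (k : Fin (2 * 2)) :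
    tensor (bit x) (bit y) k ∈ Set.Icc ((1 - |x|) / 2 * ((1 - |y|) / 2))
      ((1 + |x|) / 2 * ((1 + |y|) / 2)) := by
  obtain ⟨π, hπ⟩ := permEquiv_tensor_bit_abs x y
  rw [← hπ]
  exact tensor_bit_mem_Icc (abs_nonneg x) hx (abs_nonneg y) hy _

lemma exists_tensor_bit_eq (x y : ℝ) :
    (∃ i, tensor (bit x) (bit y) i = (1 + |x|) / 2 * ((1 + |y|) / 2)) ∧
      ∃ i, tensor (bit x) (bit y) i = (1 - |x|) / 2 * ((1 - |y|) / 2) := by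
  obtain ⟨π, hπ⟩ := permEquiv_tensor_bit_abs x y
  rw [← hπ]
  exact ⟨⟨π.symm (finProdFinEquiv (0, 0)), by simp [tensor, bit]⟩,
    ⟨π.symm (finProdFinEquiv (1, 1)), by simp [tensor, bit]⟩⟩

/-- The largest and the smallest entry distinguish the vertex, up to signs, from all other points of
the ellipse. -/
lemma exists_extreme_index {k x₀ y₀ x y : ℝ} (hk : 0.9238 < k) (hk' : k < 0.9239)
    (hx₀ : |x₀| = k / 2) (hy₀ : |y₀| = k / 2) (hx : |x| ≤ 1 / 2) (hy : |y| ≤ 1 / 2)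
    (h : (|x| + |y|) ^ 2 + 5.828 * (|x| - |y|) ^ 2 ≤ k ^ 2)
    (hne : ¬ (|x| = k / 2 ∧ |y| = k / 2)) :
    (∃ i, ∀ j, tensor (bit x) (bit y) j < tensor (bit x₀) (bit y₀) i) ∧
      ∃ i, ∀ j, tensor (bit x₀) (bit y₀) i < tensor (bit x) (bit y) j := by
  obtain ⟨⟨i, hi⟩, ⟨i', hi'⟩⟩ := exists_tensor_bit_eq x₀ y₀
  have hbd := tensor_bit_mem_Icc_abs (show |x| ≤ 1 by linarith) (show |y| ≤ 1 by linarith)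
  have hext : (1 + |x|) * (1 + |y|) < (1 + k / 2) ^ 2 ∧
      (1 - k / 2) ^ 2 < (1 - |x|) * (1 - |y|) := by
    rcases le_total |y| |x| with hyx | hxy
    · exact extreme_entries_of_mem_ellipse hk hk' (abs_nonneg y) hyx hx h hne
    · have := extreme_entries_of_mem_ellipse hk hk' (abs_nonneg x) hxy hy (by linarith)
        (fun h => hne h.symm)
      rwa [mul_comm (1 + |y|), mul_comm (1 - |y|)] at this
  rw [hx₀, hy₀] at hi hi'
  exact ⟨⟨i, fun j => (hbd j).2.trans_lt (by rw [hi]; linarith)⟩,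
    ⟨i', fun j => lt_of_lt_of_le (by rw [hi']; linarith) (hbd j).1⟩⟩

/-! ### Qubit states and spin measurements -/

lemma pauliDot_mul_add (r a : EuclideanSpace ℝ (Fin 3)) :
    pauliDot r * pauliDot a + pauliDot a * pauliDot r =
      ((2 * inner ℝ r a : ℝ) : ℂ) • (1 : Matrix (Fin 2) (Fin 2) ℂ) := by
  ext i j
  fin_cases i <;> fin_cases j <;>
    simp [pauliDot, PiLp.inner_apply, Fin.sum_univ_three] <;>
    ring_nf <;> simp [Complex.I_sq]

lemma pauliDot_isHermitian (a : EuclideanSpace ℝ (Fin 3)) : (pauliDot a).IsHermitian := by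
  ext i j
  fin_cases i <;> fin_cases j <;> simp [pauliDot]

lemma pauliDot_trace (a : EuclideanSpace ℝ (Fin 3)) : (pauliDot a).trace = 0 := by
  simp [pauliDot, Matrix.trace_fin_two]

lemma blochState_trace (a : EuclideanSpace ℝ (Fin 3)) : (blochState a).trace = 1 := by
  simp [blochState, pauliDot_trace, Matrix.trace_smul, Matrix.trace_add]

/-- For an eigenvector `v` of `a · σ`, the anticommutation relations determine the expectation of
every spin component `r · σ`. -/
lemma exists_sign_expectation {a : EuclideanSpace ℝ (Fin 3)} (ha : ‖a‖ = 1) {v : Fin 2 → ℂ}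
    (hv : star v ⬝ᵥ v = 1) {z : ℂ} (hz : pauliDot a *ᵥ v = z • v) :
    ∃ s : ℝ, (s = 1 ∨ s = -1) ∧ ∀ r, star v ⬝ᵥ (pauliDot r *ᵥ v) = ((s * inner ℝ r a : ℝ) : ℂ) := by
  have hleft : ∀ w, star v ⬝ᵥ (pauliDot a *ᵥ w) = star z * (star v ⬝ᵥ w) := by
    intro w
    rw [Matrix.dotProduct_mulVec, ← (pauliDot_isHermitian a).eq, ← Matrix.star_mulVec, hz,
      star_smul, smul_dotProduct, smul_eq_mul]
  have hzz : star z = z := by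
    have h := hleft v
    rw [hz, dotProduct_smul, hv] at h
    simpa using h.symm
  have hexp : ∀ r, z * (star v ⬝ᵥ (pauliDot r *ᵥ v)) = ((inner ℝ r a : ℝ) : ℂ) := by
    intro r
    have h := congrArg (fun M => star v ⬝ᵥ (M *ᵥ v)) (pauliDot_mul_add r a)
    simp only [Matrix.add_mulVec, dotProduct_add, ← Matrix.mulVec_mulVec, hleft, hz, hzz,
      Matrix.mulVec_smul, dotProduct_smul, Matrix.smul_mulVec, Matrix.one_mulVec, hv,
      smul_eq_mul] at h
    push_cast at h
    linear_combination h / 2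
  have hz2 : z * z = 1 := by
    have h := hexp a
    rw [hz, dotProduct_smul, hv, real_inner_self_eq_norm_sq, ha] at h
    simpa using h
  rcases mul_self_eq_one_iff.1 hz2 with rfl | rfl
  · exact ⟨1, Or.inl rfl, fun r => by simpa using hexp r⟩
  · exact ⟨-1, Or.inr rfl, fun r => by
      push_cast
      linear_combination -hexp r⟩

lemma star_dotProduct_self {d : ℕ}
    (e : OrthonormalBasis (Fin d) ℂ (EuclideanSpace ℂ (Fin d))) (i : Fin d) :
    star (e i).ofLp ⬝ᵥ (e i).ofLp = 1 := by
  have h := inner_self_eq_norm_sq_to_K (𝕜 := ℂ) (e i)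
  rw [e.orthonormal.1 i, EuclideanSpace.inner_eq_star_dotProduct, dotProduct_comm] at h
  simpa using h

lemma sum_star_dotProduct_mulVec {d : ℕ}
    (e : OrthonormalBasis (Fin d) ℂ (EuclideanSpace ℂ (Fin d))) (M : Matrix (Fin d) (Fin d) ℂ) :
    ∑ i, star (e i).ofLp ⬝ᵥ (M *ᵥ (e i).ofLp) = M.trace := by
  have h := LinearMap.trace_eq_sum_inner (Matrix.toEuclideanLin M) e
  have h2 : (Matrix.toEuclideanLin M).trace ℂ _ = M.trace := by
    rw [Matrix.toEuclideanLin_eq_toLin_orthonormal, Matrix.trace_toLin_eq]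
  rw [← h2, h]
  refine Finset.sum_congr rfl fun i _ => ?_
  rw [EuclideanSpace.inner_eq_star_dotProduct, dotProduct_comm]
  rfl

/-- The outcome distribution of a spin measurement along `a` is a bit whose bias is, up to the
labelling of the outcomes, the component of the Bloch vector along `a`. -/
lemma exists_outcomeDist_eq_bit {a : EuclideanSpace ℝ (Fin 3)} (ha : ‖a‖ = 1)
    {e : OrthonormalBasis (Fin 2) ℂ (EuclideanSpace ℂ (Fin 2))}
    (he : IsEigenbasis (pauliDot a) e) :
    ∃ s : ℝ, (s = 1 ∨ s = -1) ∧ ∀ r, outcomeDist e (blochState r) = bit (s * inner ℝ r a) := by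
  choose z hz using he
  choose s hs hsr using fun i => exists_sign_expectation ha (star_dotProduct_self e i) (hz i)
  have hsum : s 0 + s 1 = 0 := by
    have h := sum_star_dotProduct_mulVec e (pauliDot a)
    rw [pauliDot_trace, Fin.sum_univ_two, hsr, hsr, real_inner_self_eq_norm_sq, ha] at h
    norm_num at h
    exact_mod_cast h
  have hout : ∀ r i, outcomeDist e (blochState r) i = (1 + s i * inner ℝ r a) / 2 := by
    intro r i
    have h : star (e i).ofLp ⬝ᵥ (blochState r *ᵥ (e i).ofLp) =
        (((1 + s i * inner ℝ r a) / 2 : ℝ) : ℂ) := by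
      rw [blochState, Matrix.smul_mulVec, dotProduct_smul, Matrix.add_mulVec, dotProduct_add,
        Matrix.one_mulVec, star_dotProduct_self, hsr]
      push_cast
      rw [smul_eq_mul]
      ring
    rw [outcomeDist, h, Complex.ofReal_re]
  refine ⟨s 0, hs 0, fun r => funext fun i => ?_⟩
  rw [hout]
  fin_cases i
  · simp [bit]
  · have : s 1 = -s 0 := by linarith
    simp [bit, this]
    ring

/-- Every qubit state has a Bloch vector in the unit ball. -/
lemma exists_eq_blochState {ρ : Matrix (Fin 2) (Fin 2) ℂ} (hρ : ρ ∈ states 2) :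
    ∃ n, ‖n‖ ≤ 1 ∧ ρ = blochState n := by
  obtain ⟨hpos, htr⟩ := hρ
  have h01 : ρ 0 1 = star (ρ 1 0) := (hpos.1.apply 0 1).symm
  have h00 : ((ρ 0 0).re : ℂ) = ρ 0 0 := hpos.1.coe_re_apply_self 0
  have h11 : ((ρ 1 1).re : ℂ) = ρ 1 1 := hpos.1.coe_re_apply_self 1
  rw [Matrix.trace_fin_two] at htr
  have htr' : (ρ 0 0).re + (ρ 1 1).re = 1 := by
    simpa using congrArg Complex.re htr
  have hdet := (Complex.le_def.1 hpos.det_nonneg).1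
  rw [Matrix.det_fin_two, h01, ← h00, ← h11] at hdet
  simp at hdet
  refine ⟨!₂[2 * (ρ 1 0).re, 2 * (ρ 1 0).im, (ρ 0 0).re - (ρ 1 1).re], ?_, ?_⟩
  · rw [EuclideanSpace.norm_eq, Real.sqrt_le_one]
    simp [Fin.sum_univ_three]
    nlinarith
  · have hre : (ρ 0 1).re = (ρ 1 0).re := by rw [h01]; simp
    have him : (ρ 0 1).im = -(ρ 1 0).im := by rw [h01]; simp
    have him0 : (ρ 0 0).im = 0 := by rw [← h00]; simp
    have him1 : (ρ 1 1).im = 0 := by rw [← h11]; simp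
    ext i j
    fin_cases i <;> fin_cases j <;>
      simp [blochState, pauliDot, Complex.ext_iff, hre, him, him0, him1] <;> linarith

/-- A Bloch vector on the unit sphere belongs to a pure state. -/
lemma exists_vecMulVec_eq_blochState {n : EuclideanSpace ℝ (Fin 3)} (hn : ‖n‖ = 1) :
    ∃ ψ : EuclideanSpace ℂ (Fin 2), ‖ψ‖ = 1 ∧
      Matrix.vecMulVec ψ.ofLp (star ψ.ofLp) = blochState n := by
  have hn2 : n 0 ^ 2 + n 1 ^ 2 + n 2 ^ 2 = 1 := by
    have h := EuclideanSpace.real_norm_sq_eq n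
    rw [hn, Fin.sum_univ_three] at h
    linarith
  suffices h : ∃ ψ : EuclideanSpace ℂ (Fin 2),
      Matrix.vecMulVec ψ.ofLp (star ψ.ofLp) = blochState n by
    obtain ⟨ψ, hψ⟩ := h
    refine ⟨ψ, ?_, hψ⟩
    have h := congrArg Matrix.trace hψ
    rw [blochState_trace, Matrix.trace_vecMulVec, ← EuclideanSpace.inner_eq_star_dotProduct,
      inner_self_eq_norm_sq_to_K] at h
    have h' : ‖ψ‖ ^ 2 = 1 := Complex.ofReal_injective (by push_cast; exact h)
    exact (pow_eq_one_iff_of_nonneg (norm_nonneg ψ) two_ne_zero).1 h'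
  by_cases h2 : n 2 = -1
  · have h0 : n 0 = 0 := by nlinarith [sq_nonneg (n 0), sq_nonneg (n 1)]
    have h1 : n 1 = 0 := by nlinarith [sq_nonneg (n 0), sq_nonneg (n 1)]
    refine ⟨!₂[0, 1], ?_⟩
    ext i j
    fin_cases i <;> fin_cases j <;> simp [blochState, pauliDot, Matrix.vecMulVec, h0, h1, h2]
    norm_num
  · have hpos : 0 < 1 + n 2 := by
      refine lt_of_le_of_ne (by nlinarith [sq_nonneg (n 0), sq_nonneg (n 1)]) fun h => h2 ?_
      linarith
    obtain ⟨t, ht, htt⟩ : ∃ t : ℝ, 0 < t ∧ t * t = (1 + n 2) / 2 :=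
      ⟨√((1 + n 2) / 2), Real.sqrt_pos.2 (by linarith), Real.mul_self_sqrt (by linarith)⟩
    refine ⟨!₂[(t : ℂ), ((n 0 / (2 * t) : ℝ) : ℂ) + ((n 1 / (2 * t) : ℝ) : ℂ) * Complex.I], ?_⟩
    have e0 : t * (n 0 / (2 * t)) = n 0 / 2 := by field_simp
    have e1 : t * (n 1 / (2 * t)) = n 1 / 2 := by field_simp
    have e2 : n 0 / (2 * t) * (n 0 / (2 * t)) + n 1 / (2 * t) * (n 1 / (2 * t)) =
        (1 - n 2) / 2 := by
      have : n 0 / (2 * t) * (n 0 / (2 * t)) + n 1 / (2 * t) * (n 1 / (2 * t)) =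
          (n 0 ^ 2 + n 1 ^ 2) / (4 * (t * t)) := by
        field_simp
        ring
      rw [this, htt, div_eq_iff (by positivity)]
      linarith
    ext i j
    fin_cases i <;> fin_cases j <;> rw [Complex.ext_iff] <;> constructor <;>
      simp [blochState, pauliDot, Matrix.vecMulVec, -Complex.ofReal_div, -Complex.ofReal_mul] <;>
      linarith

lemma vecMulVec_mem_states {d : ℕ} {ψ : EuclideanSpace ℂ (Fin d)} (hψ : ‖ψ‖ = 1) :
    Matrix.vecMulVec ψ.ofLp (star ψ.ofLp) ∈ states d := by
  refine ⟨Matrix.posSemidef_vecMulVec_self_star _, ?_⟩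
  have h := inner_self_eq_norm_sq_to_K (𝕜 := ℂ) ψ
  rw [hψ, EuclideanSpace.inner_eq_star_dotProduct] at h
  rw [Matrix.trace_vecMulVec]
  simpa using h

lemma mem_noisyStates_of_mem_pseudoPureStates {d : ℕ} {ε : ℝ} {τ : Matrix (Fin d) (Fin d) ℂ}
    (h : τ ∈ pseudoPureStates d ε) : τ ∈ noisyStates d ε := by
  obtain ⟨ψ, hψ, rfl⟩ := h
  exact ⟨_, vecMulVec_mem_states hψ, rfl⟩

lemma noise_blochState (ε : ℝ) (n : EuclideanSpace ℝ (Fin 3)) :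
    ((ε / (2 : ℕ) : ℝ) : ℂ) • (1 : Matrix (Fin 2) (Fin 2) ℂ) + ((1 - ε : ℝ) : ℂ) • blochState n =
      blochState ((1 - ε) • n) := by
  ext i j
  fin_cases i <;> fin_cases j <;> simp [blochState, pauliDot] <;> ring

lemma exists_blochState_of_mem_noisyStates {ε : ℝ} (hε : ε ≤ 1) {τ : Matrix (Fin 2) (Fin 2) ℂ}
    (h : τ ∈ noisyStates 2 ε) : ∃ n, ‖n‖ ≤ 1 - ε ∧ τ = blochState n := by
  obtain ⟨ρ, hρ, rfl⟩ := h
  obtain ⟨n, hn, rfl⟩ := exists_eq_blochState hρ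
  refine ⟨(1 - ε) • n, ?_, noise_blochState ε n⟩
  rw [norm_smul, Real.norm_of_nonneg (by linarith)]
  exact mul_le_of_le_one_right (by linarith) hn

lemma blochState_mem_pseudoPureStates {ε : ℝ} {n : EuclideanSpace ℝ (Fin 3)} (hn : ‖n‖ = 1) :
    blochState ((1 - ε) • n) ∈ pseudoPureStates 2 ε := by
  obtain ⟨ψ, hψ, h⟩ := exists_vecMulVec_eq_blochState hn
  exact ⟨ψ, hψ, by rw [h, noise_blochState]⟩

/-! ### Spin components at angle `π / 4` -/

lemma inner_eq_of_angle {a b : EuclideanSpace ℝ (Fin 3)} (ha : ‖a‖ = 1) (hb : ‖b‖ = 1)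
    (hab : InnerProductGeometry.angle a b = Real.pi / 4) : inner ℝ a b = √2 / 2 := by
  rw [← InnerProductGeometry.cos_angle_mul_norm_mul_norm, hab, ha, hb, Real.cos_pi_div_four]
  ring

lemma norm_add_sq_of_inner_eq {a b : EuclideanSpace ℝ (Fin 3)} (ha : ‖a‖ = 1) (hb : ‖b‖ = 1)
    (hab : inner ℝ a b = √2 / 2) : ‖a + b‖ ^ 2 = 2 + √2 := by
  rw [norm_add_sq_real, hab, ha, hb]
  ring

/-- Nonnegativity of the Gram determinant of `a`, `b` and `n`. -/
lemma two_mul_inner_sq_le {a b : EuclideanSpace ℝ (Fin 3)} (ha : ‖a‖ = 1) (hb : ‖b‖ = 1)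
    (hab : inner ℝ a b = √2 / 2) (n : EuclideanSpace ℝ (Fin 3)) :
    2 * (inner ℝ n a ^ 2 + inner ℝ n b ^ 2 - √2 * inner ℝ n a * inner ℝ n b) ≤ ‖n‖ ^ 2 := by
  -- the vector is `n` minus its orthogonal projection to the plane of `a` and `b`
  have h := real_inner_self_nonneg (x := n - (2 * inner ℝ n a - √2 * inner ℝ n b) • a -
    (2 * inner ℝ n b - √2 * inner ℝ n a) • b)
  simp only [inner_sub_left, inner_sub_right, real_inner_smul_left, real_inner_smul_right,
    real_inner_comm n a, real_inner_comm n b, real_inner_comm a b, hab] at h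
  rw [real_inner_self_eq_norm_sq, real_inner_self_eq_norm_sq, real_inner_self_eq_norm_sq, ha, hb]
    at h
  have h2 : √2 * √2 = 2 := Real.mul_self_sqrt (by norm_num)
  linear_combination
    h - (inner ℝ n a ^ 2 + inner ℝ n b ^ 2 - √2 * inner ℝ n a * inner ℝ n b) * h2

/-- The spin components of a Bloch vector of norm at most `1 / 2` lie in an ellipse. -/
lemma abs_inner_mem_ellipse {a b n : EuclideanSpace ℝ (Fin 3)} (ha : ‖a‖ = 1) (hb : ‖b‖ = 1)
    (hab : inner ℝ a b = √2 / 2) (hn : ‖n‖ ≤ 1 / 2) :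
    (|inner ℝ n a| + |inner ℝ n b|) ^ 2 + 5.828 * (|inner ℝ n a| - |inner ℝ n b|) ^ 2 ≤
      (‖a + b‖ / 2) ^ 2 := by
  have h := two_mul_inner_sq_le ha hb hab n
  have hn2 : ‖n‖ ^ 2 ≤ 1 / 4 := by nlinarith [norm_nonneg n]
  have h2 : √2 * √2 = 2 := Real.mul_self_sqrt (by norm_num)
  have h3 : (1.4142 : ℝ) < √2 := Real.lt_sqrt_of_sq_lt (by norm_num)
  rw [div_pow, norm_add_sq_of_inner_eq ha hb hab]
  set x := inner ℝ n a
  set y := inner ℝ n b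
  have h4 : (x + y) ^ 2 + (3 + 2 * √2) * (x - y) ^ 2 ≤ (2 + √2) / 4 := by
    have h5 := mul_le_mul_of_nonneg_left (h.trans hn2) (show 0 ≤ 2 + √2 by positivity)
    have e : (2 + √2) * (2 * (x ^ 2 + y ^ 2 - √2 * x * y)) =
        (x + y) ^ 2 + (3 + 2 * √2) * (x - y) ^ 2 := by
      linear_combination (-2 * x * y) * h2
    linarith
  have h5 : 5.828 * (x - y) ^ 2 ≤ (3 + 2 * √2) * (x - y) ^ 2 :=
    mul_le_mul_of_nonneg_right (by linarith) (sq_nonneg _)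
  have h6 : x * y ≤ |x| * |y| := by
    rw [← abs_mul]
    exact le_abs_self _
  nlinarith [sq_abs x, sq_abs y]

lemma abs_sign_mul {s x : ℝ} (hs : s = 1 ∨ s = -1) : |s * x| = |x| := by
  rcases hs with rfl | rfl <;> simp

lemma isUniversalMUS_of_isCatalyst {e f : OrthonormalBasis (Fin 2) ℂ (EuclideanSpace ℂ (Fin 2))}
    {S : Set (Matrix (Fin 2) (Fin 2) ℂ)} {ρ : Matrix (Fin 2) (Fin 2) ℂ}
    {F : Set UncertaintyFunction}
    (hF : F ⊆ familyU) (hρ : ρ ∈ S)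
    (hS : ∀ σ ∈ S, jointDist e f σ ∈ stdSimplex ℝ (Fin (2 * 2)) ∧ ∀ i, 0 < jointDist e f σ i)
    (hcat : ∀ σ ∈ S, ∃ (n : ℕ) (c : Fin n → ℝ), IsCatalyst c (jointDist e f ρ) (jointDist e f σ))
    (hmax : ∀ σ ∈ S, ¬ PermEquiv (jointDist e f ρ) (jointDist e f σ) →
      ∃ i, ∀ j, jointDist e f σ j < jointDist e f ρ i) :
    IsUniversalMUS F e f S ρ := by
  refine ⟨hρ, fun σ hσ u hu => ?_, fun σ hσ hne u hu hus => ?_⟩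
  · obtain ⟨n, c, hc⟩ := hcat σ hσ
    exact hc.le_of_mem_familyU (hS ρ hρ).1 (hS σ hσ).1 (hF hu)
  · obtain ⟨n, c, hc⟩ := hcat σ hσ
    exact hc.lt_of_mem_familyU (hS ρ hρ).1 (hS σ hσ).1 (hS ρ hρ).2 (hS σ hσ).2
      (hmax σ hσ hne) (hF hu) hus

end MUS

theorem mainTheorem2
    (a b : EuclideanSpace ℝ (Fin 3)) (ha : ‖a‖ = 1) (hb : ‖b‖ = 1)
    (hab : InnerProductGeometry.angle a b = Real.pi / 4)
    (e f : OrthonormalBasis (Fin 2) ℂ (EuclideanSpace ℂ (Fin 2)))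
    (he : MUS.IsEigenbasis (MUS.pauliDot a) e) (hf : MUS.IsEigenbasis (MUS.pauliDot b) f)
    (r : EuclideanSpace ℝ (Fin 3))
    (hr : r = (1 / 2 : ℝ) • (‖a + b‖⁻¹ • (a + b)) ∨
      r = -((1 / 2 : ℝ) • (‖a + b‖⁻¹ • (a + b)))) :
    MUS.blochState r ∈ MUS.pseudoPureStates 2 (1 / 2) ∧
    MUS.IsUniversalMUS MUS.familyU e f (MUS.noisyStates 2 (1 / 2)) (MUS.blochState r) ∧
    MUS.IsUniversalMUS MUS.familyUPlus e f (MUS.noisyStates 2 (1 / 2)) (MUS.blochState r) ∧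
    ∀ σ ∈ MUS.noisyStates 2 (1 / 2),
      ¬ MUS.PermEquiv (MUS.jointDist e f (MUS.blochState r)) (MUS.jointDist e f σ) →
        ∀ α : EReal, MUS.renyi α (MUS.jointDist e f (MUS.blochState r)) <
          MUS.renyi α (MUS.jointDist e f σ) := by
  have hin := MUS.inner_eq_of_angle ha hb hab
  have hnorm := MUS.norm_add_sq_of_inner_eq ha hb hin
  have h1 : (1.4142 : ℝ) < √2 := Real.lt_sqrt_of_sq_lt (by norm_num)
  have h2 : √2 < (1.4143 : ℝ) := (Real.sqrt_lt' (by norm_num)).2 (by norm_num)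
  have hpos : 0 < ‖a + b‖ := by
    refine lt_of_le_of_ne (norm_nonneg _) fun h => ?_
    rw [← h] at hnorm
    linarith
  obtain ⟨k, hk⟩ : ∃ k, k = ‖a + b‖ / 2 := ⟨_, rfl⟩
  have hk1 : 0.9238 < k := by rw [hk]; nlinarith
  have hk2 : k < 0.9239 := by rw [hk]; nlinarith
  obtain ⟨s, hs, hes⟩ := MUS.exists_outcomeDist_eq_bit ha he
  obtain ⟨t, ht, hft⟩ := MUS.exists_outcomeDist_eq_bit hb hf
  have hjoint : ∀ n, MUS.jointDist e f (MUS.blochState n) =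
      MUS.tensor (MUS.bit (s * inner ℝ n a)) (MUS.bit (t * inner ℝ n b)) := fun n => by
    rw [MUS.jointDist, hes, hft]
  -- both components of `r` have modulus `‖a + b‖ / 4`
  have hra : |inner ℝ r a| = k / 2 ∧ |inner ℝ r b| = k / 2 := by
    have e1 : inner ℝ (a + b) a = ‖a + b‖ ^ 2 / 2 := by
      rw [inner_add_left, real_inner_self_eq_norm_sq, real_inner_comm, hin, ha, hnorm]
      ring
    have e2 : inner ℝ (a + b) b = ‖a + b‖ ^ 2 / 2 := by
      rw [inner_add_left, real_inner_self_eq_norm_sq, hin, hb, hnorm]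
      ring
    have e3 : 1 / 2 * (‖a + b‖⁻¹ * (‖a + b‖ ^ 2 / 2)) = k / 2 := by
      rw [hk]
      field_simp
    have e4 : |k / 2| = k / 2 := abs_of_pos (by linarith)
    rcases hr with rfl | rfl <;>
      simp only [inner_neg_left, real_inner_smul_left, e1, e2, e3, abs_neg, e4, and_self]
  have hpseudo : MUS.blochState r ∈ MUS.pseudoPureStates 2 (1 / 2) := by
    obtain ⟨n, hn, rfl⟩ : ∃ n : EuclideanSpace ℝ (Fin 3), ‖n‖ = 1 ∧
        r = (1 - 1 / 2 : ℝ) • n := by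
      have hu : ‖‖a + b‖⁻¹ • (a + b)‖ = 1 := by
        rw [norm_smul, norm_inv, norm_norm, inv_mul_cancel₀ hpos.ne']
      rcases hr with rfl | rfl
      · exact ⟨_, hu, by norm_num⟩
      · exact ⟨-(‖a + b‖⁻¹ • (a + b)), by rw [norm_neg, hu], by rw [smul_neg]; norm_num⟩
    exact MUS.blochState_mem_pseudoPureStates hn
  have hnoisy := MUS.mem_noisyStates_of_mem_pseudoPureStates hpseudo
  have hbloch : ∀ σ ∈ MUS.noisyStates 2 (1 / 2), ∃ x y : ℝ,
      MUS.jointDist e f σ = MUS.tensor (MUS.bit x) (MUS.bit y) ∧ |x| ≤ 1 / 2 ∧ |y| ≤ 1 / 2 ∧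
        (|x| + |y|) ^ 2 + 5.828 * (|x| - |y|) ^ 2 ≤ k ^ 2 := by
    intro σ hσ
    obtain ⟨n, hn, rfl⟩ := MUS.exists_blochState_of_mem_noisyStates (by norm_num) hσ
    norm_num only at hn
    refine ⟨_, _, hjoint n, ?_, ?_, ?_⟩
    · rw [MUS.abs_sign_mul hs]
      exact (abs_real_inner_le_norm n a).trans (by rwa [ha, mul_one])
    · rw [MUS.abs_sign_mul ht]
      exact (abs_real_inner_le_norm n b).trans (by rwa [hb, mul_one])
    · rw [MUS.abs_sign_mul hs, MUS.abs_sign_mul ht, hk]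
      exact MUS.abs_inner_mem_ellipse ha hb hin hn
  have hx₀ : |s * inner ℝ r a| = k / 2 := by rw [MUS.abs_sign_mul hs, hra.1]
  have hy₀ : |t * inner ℝ r b| = k / 2 := by rw [MUS.abs_sign_mul ht, hra.2]
  have hS : ∀ σ ∈ MUS.noisyStates 2 (1 / 2), MUS.jointDist e f σ ∈ stdSimplex ℝ (Fin (2 * 2)) ∧
      ∀ i, 0 < MUS.jointDist e f σ i := by
    intro σ hσ
    obtain ⟨x, y, hxy, hx, hy, -⟩ := hbloch σ hσ
    rw [hxy]
    exact ⟨MUS.tensor_mem_stdSimplex (MUS.bit_mem_stdSimplex (by linarith))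
      (MUS.bit_mem_stdSimplex (by linarith)),
      MUS.tensor_pos (MUS.bit_pos (by linarith)) (MUS.bit_pos (by linarith))⟩
  have hcat : ∀ σ ∈ MUS.noisyStates 2 (1 / 2), ∃ (n : ℕ) (c : Fin n → ℝ),
      MUS.IsCatalyst c (MUS.jointDist e f (MUS.blochState r)) (MUS.jointDist e f σ) := by
    intro σ hσ
    obtain ⟨x, y, hxy, hx, hy, h⟩ := hbloch σ hσ
    rw [hxy, hjoint]
    exact MUS.exists_isCatalyst_of_mem_ellipse hk1 hk2 hx₀ hy₀ hx hy h
  have hext : ∀ σ ∈ MUS.noisyStates 2 (1 / 2),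
      ¬ MUS.PermEquiv (MUS.jointDist e f (MUS.blochState r)) (MUS.jointDist e f σ) →
      (∃ i, ∀ j, MUS.jointDist e f σ j < MUS.jointDist e f (MUS.blochState r) i) ∧
        ∃ i, ∀ j, MUS.jointDist e f (MUS.blochState r) i < MUS.jointDist e f σ j := by
    intro σ hσ hne
    obtain ⟨x, y, hxy, hx, hy, h⟩ := hbloch σ hσ
    rw [hxy, hjoint] at hne ⊢
    exact MUS.exists_extreme_index hk1 hk2 hx₀ hy₀ hx hy h fun hxy' =>
      hne ((MUS.permEquiv_bit (hx₀.trans hxy'.1.symm)).tensor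
        (MUS.permEquiv_bit (hy₀.trans hxy'.2.symm)))
  refine ⟨hpseudo, MUS.isUniversalMUS_of_isCatalyst subset_rfl hnoisy hS hcat
    fun σ hσ hne => (hext σ hσ hne).1, MUS.isUniversalMUS_of_isCatalyst (fun u hu => hu.1) hnoisy hS
    hcat fun σ hσ hne => (hext σ hσ hne).1, fun σ hσ hne α => ?_⟩
  obtain ⟨n, c, hc⟩ := hcat σ hσ
  exact hc.renyi_lt (hS _ hnoisy).1 (hS σ hσ).1 (hS _ hnoisy).2 (hS σ hσ).2 (hext σ hσ hne).1
    (hext σ hσ hne).2 α
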